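/- **Notation.** Let $x_1,\dots,x_n$ be commuting variables and $\theta_1,\dots,\theta_n$ anticommuting variables which commute with the $x$'s, and work in $\mathbb{Q}[x_1,\dots,x_n,\theta_1,\dots,\theta_n]$. For a polynomial $g(x_1,\dots,x_n)$ let $\partial_g = g(\partial_{x_1},\dots,\partial_{x_n})$ be the associated differential operator (acting on coefficients of forms). Put $$\mathrm{d}_i := \sum_{a=1}^n \partial_{x_a}^i\,\theta_a ,\qquad \mathrm{d}_J := \mathrm{d}_{j_1}\cdots \mathrm{d}_{j_k}\ \text{ for } J=\{j_1<\dots<j_k\}\subset\{1,\dots,n-1\},$$ $$\Delta_m(y_1,\dots,y_m) := \prod_{1\le v<w\le m}(y_w-y_v),\qquad \Delta_n := \Delta_n(x_1,\dots,x_n),$$ and let $e_r(x_1,\dots,x_m)$ denote the elementary symmetric polynomial of degree $r$ in the first $m$ variables. Subsets $I\subset\{1,\dots,n-1\}$ are sent to strong compositions $\Phi_n(I)$ of $n$ recursively: $\Phi_n(\varnothing)=(1^n)$; if $|I|=k>0$, let $\overline I=\{i-(n-k) : i\in I,\ i>n-k\}\subset\{1,\dots,k-1\}$ and $\beta=\Phi_k(\overline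 I)$. Then $\Phi_n(I)=\alpha$ is the composition with $n-k$ parts such that $\{p:\alpha_p>1\}=\{n-k+1-i : i\in I,\ i\le n-k\}$ and $\overline\alpha=\beta$, where $\overline\alpha$ is obtained from $\alpha$ by subtracting $1$ from every part and deleting zeros. **Theorem (extreme hook relations).** Let $1\le s\le k$ and $I=\{i_1<\dots<i_k\}\subset\{1,\dots,n-1\}$. Then the condition $$(\ast)\qquad i_1,\dots,i_{k-s+1}\le n-k\quad\text{and}\quad i_{k-s+1+t}=n-s+t\ \text{ for } 1\le t\le s-1$$ holds if and only if $\overline{\Phi_n(I)}=(s,1^{k-s})$. If $(\ast)$ holds, then for every integer $0\le u\le s$, $$\sum_{J}(-1)^d\,\Delta_s(j_{k-s+1},\dots,j_k)\binom{d+u}{u}\,\partial_{e_{n-s-d}(x_1,\dots,x_{n-s+u})}\,\mathrm{d}_J\Delta_n=0,$$ where the sum is over all subsets $J=\{j_1<\dots<j_k\}\subset\{1,\dots,n-1\}$ with $j_1=i_1,\dots,j_{k-s}=i_{k-s}$ and $$d:=(j_{k-s+1}-i_{k-s+1})+\dots+(j_k-i_k)\ge 0 .$$ -/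

import Mathlib

open scoped TensorProduct

noncomputable section

namespace HarmonicForms

/-- The Vandermonde product `∏_{a < b} (v_b - v_a)` of a finite list of ring elements. -/
def vdm {R : Type*} [CommRing R] {m : ℕ} (v : Fin m → R) : R :=
  ∏ a : Fin m, ∏ b ∈ Finset.Ioi a, (v b - v a)

/-- The polynomial ring `ℚ[x_1, …, x_n]`; the variable `x_{a+1}` is `MvPolynomial.X a`. -/
abbrev Poly (n : ℕ) : Type := MvPolynomial (Fin n) ℚ

/-- The ring `ℚ[x_1, …, x_n, θ_1, …, θ_n]` of differential forms on `ℚ^n` with polynomial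
coefficients: the `x`'s commute with everything and the `θ`'s anticommute, so it is
`ℚ[x_1, …, x_n] ⊗ Λ(θ_1, …, θ_n)`. -/
abbrev Forms (n : ℕ) : Type := Poly n ⊗[ℚ] ExteriorAlgebra ℚ (Fin n → ℚ)

/-- The anticommuting variable `θ_{a+1}`. -/
def theta (n : ℕ) (a : Fin n) : ExteriorAlgebra ℚ (Fin n → ℚ) :=
  ExteriorAlgebra.ι ℚ (Pi.single a 1)

/-- The operator `∂/∂x_{a+1}` on polynomials. -/
def partialX (n : ℕ) (a : Fin n) : Module.End ℚ (Poly n) :=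
  (MvPolynomial.pderiv (R := ℚ) a).toLinearMap

/-- The constant coefficient differential operator `∂_g` on polynomials: every variable of `g`
is replaced by the corresponding partial derivative. -/
def polyDiff {n : ℕ} (g : Poly n) : Module.End ℚ (Poly n) :=
  ∑ m ∈ g.support, g.coeff m • ((List.finRange n).map fun a => partialX n a ^ m a).prod

/-- The operator `∂_g` on differential forms, acting on the coefficients. -/
def formDiff {n : ℕ} (g : Poly n) : Module.End ℚ (Forms n) :=
  (polyDiff g).rTensor (ExteriorAlgebra ℚ (Fin n → ℚ))

/-- The generalized exterior derivative `d_i = ∑_a (∂/∂x_a)^i θ_a`. -/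
def genD (n i : ℕ) : Module.End ℚ (Forms n) :=
  ∑ a : Fin n, TensorProduct.map (partialX n a ^ i) (LinearMap.mulLeft ℚ (theta n a))

/-- The Vandermonde determinant `Δ_n`, as a `0`-form. -/
def vandermondeForm (n : ℕ) : Forms n :=
  vdm (fun a : Fin n => (MvPolynomial.X a : Poly n)) ⊗ₜ[ℚ] 1

/-- `d_J Δ_n = d_{j_1} ⋯ d_{j_k} Δ_n`. -/
def dVandermonde (n : ℕ) {k : ℕ} (j : Fin k → ℕ) : Forms n :=
  (List.ofFn fun l => genD n (j l)).prod (vandermondeForm n)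

/-- The elementary symmetric polynomial `e_r(x_1, …, x_m)` inside `ℚ[x_1, …, x_n]` (`m ≤ n`),
for an integer `r`; it is zero for `r < 0`. -/
def elemSymm (n m : ℕ) (r : ℤ) : Poly n :=
  ∑ S : Finset (Fin n) with (∀ a : Fin n, a ∈ S → (a : ℕ) < m) ∧ (S.card : ℤ) = r,
    ∏ a ∈ S, MvPolynomial.X a

/-- The last `s` entries of a `k`-tuple. -/
def lastEntries {k s : ℕ} (h : s ≤ k) (j : Fin k → ℕ) : Fin s → ℕ :=
  fun t => j ⟨k - s + t, by have := t.isLt; omega⟩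

/-- `d = (j_{k-s+1} - i_{k-s+1}) + ⋯ + (j_k - i_k)`. -/
def excess {k s : ℕ} (h : s ≤ k) (i j : Fin k → ℕ) : ℤ :=
  ∑ t : Fin s, (((lastEntries h j t : ℕ) : ℤ) - ((lastEntries h i t : ℕ) : ℤ))

open Classical in
/-- The `k`-element subsets `J = {j_1 < ⋯ < j_k}` of `{1, …, n-1}`, written as increasing tuples,
that agree with `i` in the first `k - s` entries and have `d ≥ 0`. -/
def admissible (n : ℕ) {k s : ℕ} (h : s ≤ k) (i : Fin k → ℕ) : Finset (Fin k → ℕ) :=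
  {j ∈ Fintype.piFinset fun _ : Fin k => Finset.Icc 1 (n - 1) |
    StrictMono j ∧ (∀ l : Fin k, (l : ℕ) < k - s → j l = i l) ∧ 0 ≤ excess h i j}

/-- The condition `i_1, …, i_{k-s+1} ≤ n - k` and `i_{k-s+1+t} = n - s + t` for
`1 ≤ t ≤ s - 1`; the entry `i_{l+1}` is `i l`. -/
def IsExtremeHook (n s : ℕ) {k : ℕ} (i : Fin k → ℕ) : Prop :=
  (∀ l : Fin k, (l : ℕ) ≤ k - s → i l ≤ n - k) ∧
    ∀ (l : Fin k) (t : ℕ), 1 ≤ t → (l : ℕ) = k - s + t → i l = n - s + t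

/-- The strong composition `Φ_n(I)` of `n` attached to a subset `I` of `{1, …, n-1}`. If `I` is
empty it is `(1, …, 1)`. Otherwise, with `k = |I|`, let `I' = {i - (n-k) : i ∈ I, i > n-k}`, a
subset of `{1, …, k-1}`, and `β = Φ_k(I')`. Then `Φ_n(I)` has `n - k` entries; the positions of
its entries exceeding `1` are the numbers `p = n - k + 1 - i` with `i ∈ I`, `i ≤ n - k`, and
these entries are, from left to right, `1 + β_1, 1 + β_2, …`. In the code `p = a + 1`. -/
def Phi (n : ℕ) (I : Finset ℕ) : List ℕ :=
  if _h : 0 < I.card ∧ I.card < n then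
    (List.range (n - I.card)).map fun a =>
      if n - I.card - a ∈ I then
        1 + (Phi I.card ({i ∈ I | n - I.card < i}.image fun i => i - (n - I.card))).getD
          {i ∈ I | n - I.card - a < i ∧ i ≤ n - I.card}.card 0
      else 1
  else List.replicate n 1
termination_by n
decreasing_by exact _h.2

/-- The composition obtained by subtracting `1` from each entry and deleting zeros. -/
def reduced (α : List ℕ) : List ℕ := (α.map fun a => a - 1).filter fun a => a ≠ 0

end HarmonicForms

end

namespace HarmonicForms

open MvPolynomial

/-! ### Constant coefficient differential operators and multiplication by the sum of the variables.
-/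

section Operators

variable {n : ℕ}

/-! The form `d_J Δ_n` expands over tuples `a` of indices: the coefficient of `θ_{a_1} ⋯ θ_{a_k}` is
`∏ x_{a_l}^{j_l}`, read as a differential operator, applied to `Δ_n`, and only injective `a` matter.
Permuting the last `s` entries of `j` changes `Δ_s(j)` and the form by the same sign, so one may sum
over all tuples instead of increasing ones. What remains is that certain polynomials lie in the
annihilator of `Δ_n` (`sum_vdm_smul_hookCoeff_mem`).

Modulo that annihilator `∏ (1 - q x_a) = 1`, so `1 - q x_b` is inverted by the product of the other
factors. The generating function of the numbers `Δ_s(j)` is, up to factorials, the determinant of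
`z_v^i / (1 - z_v)^(i+1)` with `z_v = q x_{b v}`; it becomes a signed sum of products `∏ (1 - q
x_a)^(μ_a)`, where `μ` permutes `0, …, s-1` on the image of `b` and equals `s` elsewhere
(`sum_vdm_smul_prod_pow`). The binomially weighted `e_r` are, up to sign, the coefficients of `∑_T
∏_{a ∈ T} (1 - q x_a)` over `(n-s)`-subsets `T` of the first `n-s+u` indices (`coeff_linFactorSum`);
multiplying by them raises `μ` by one on `T`.

The high coefficients in `q` of such a product annihilate `Δ_n`
(`coeff_prod_linFactor_hookExponent_mem`). The leading one, `± x^μ`, kills `(∑ x_a)^l Δ_n` for `l <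
n - s`: by alternation the exponents there are distinct, and distinct exponents dominating `μ` have
too large a sum (`choose_add_le_sum_of_hookExponent_le`). Commutators with multiplication by `∑ x_a`
pass this on to lower coefficients (`IsLinearProduct.polyDiffHom_coeff`).

For the equivalence, both conditions say that the shifted upper part of `I` is `{k-s+1, …, k-1}`
(`reduced_Phi`, `Phi_eq_cons_replicate_iff`, `isExtremeHook_iff_upperPart`). -/

theorem partialX_comm (a b : Fin n) : partialX n a * partialX n b = partialX n b * partialX n a := by
  refine LinearMap.ext fun f => ?_
  induction f using MvPolynomial.induction_on' with
  | monomial m c =>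
    rcases eq_or_ne a b with rfl | hab
    · rfl
    · simp only [partialX, Module.End.mul_apply, Derivation.coeFn_coe, pderiv_monomial,
        Finsupp.coe_tsub, Pi.sub_apply, Finsupp.single_eq_of_ne hab,
        Finsupp.single_eq_of_ne hab.symm, tsub_zero]
      rw [tsub_right_comm, mul_right_comm]
  | add p q hp hq => rw [map_add, map_add, hp, hq]

/-- The commutative algebra of operators generated by the partial derivatives. -/
noncomputable abbrev diffOps (n : ℕ) : Subalgebra ℚ (Module.End ℚ (Poly n)) :=
  Algebra.adjoin ℚ (Set.range (partialX n))

/-- `aeval` needs a commutative target, which the full endomorphism ring is not. -/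
noncomputable instance diffOpsCommRing (n : ℕ) : CommRing (diffOps n) :=
  { Subalgebra.toRing (diffOps n) with
    mul_comm := (Algebra.isMulCommutative_adjoin ℚ (by
      rintro _ ⟨a, rfl⟩ _ ⟨b, rfl⟩
      exact partialX_comm a b)).is_comm.comm }

/-- The algebra homomorphism sending a polynomial to its constant coefficient differential
operator. -/
noncomputable def polyDiffHom (n : ℕ) : Poly n →ₐ[ℚ] Module.End ℚ (Poly n) :=
  (diffOps n).val.comp
    (aeval fun a => (⟨partialX n a, Algebra.subset_adjoin ⟨a, rfl⟩⟩ : diffOps n))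

theorem polyDiffHom_apply (g : Poly n) : polyDiffHom n g = polyDiff g := by
  rw [polyDiffHom, AlgHom.comp_apply, aeval_def, eval₂_eq', map_sum, polyDiff]
  refine Finset.sum_congr rfl fun m _ => ?_
  rw [← Algebra.smul_def, map_smul, ← List.prod_ofFn, map_list_prod, List.ofFn_eq_map,
    List.map_map]
  rfl

theorem polyDiffHom_X (a : Fin n) : polyDiffHom n (X a) = partialX n a := by
  simp [polyDiffHom]

theorem partialX_pow_monomial (a : Fin n) (k : ℕ) (m : Fin n →₀ ℕ) (c : ℚ) (h : m a < k) :
    (partialX n a ^ k) (monomial m c) = 0 := by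
  induction k generalizing m c with
  | zero => omega
  | succ k ih =>
    rw [pow_succ, Module.End.mul_apply]
    simp only [partialX, Derivation.coeFn_coe, pderiv_monomial] at ih ⊢
    by_cases hm : m a = 0
    · simp [hm]
    · apply ih
      simp only [Finsupp.coe_tsub, Pi.sub_apply, Finsupp.single_eq_same]
      omega

theorem polyDiffHom_prod_X_pow_eq_zero (μ : Fin n → ℕ) (f : Poly n)
    (h : ∀ ξ ∈ f.support, ∃ a, ξ a < μ a) : polyDiffHom n (∏ a, X a ^ μ a) f = 0 := by
  rw [f.as_sum, map_sum]
  refine Finset.sum_eq_zero fun ξ hξ => ?_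
  obtain ⟨a, ha⟩ := h ξ hξ
  rw [← Finset.prod_erase_mul _ _ (Finset.mem_univ a), map_mul, map_pow, polyDiffHom_X,
    Module.End.mul_apply, partialX_pow_monomial a _ _ _ ha, map_zero]

/-- The derivation `∑ ∂/∂x_a` of the polynomial ring. -/
noncomputable def sumDeriv (n : ℕ) : Derivation ℚ (Poly n) (Poly n) :=
  mkDerivation ℚ fun _ => 1

theorem sumDeriv_X (a : Fin n) : sumDeriv n (X a) = 1 :=
  mkDerivation_X ℚ _ a

/-- The commutator of a constant coefficient operator with multiplication by `∑ x_a`. -/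
theorem polyDiffHom_sum_X_mul (g f : Poly n) :
    polyDiffHom n g ((∑ a, X a) * f) =
      (∑ a, X a) * polyDiffHom n g f + polyDiffHom n (sumDeriv n g) f := by
  induction g using MvPolynomial.induction_on generalizing f with
  | C c =>
    simp only [← algebraMap_eq, AlgHom.commutes, Module.algebraMap_end_apply,
      Derivation.map_algebraMap, map_zero, LinearMap.zero_apply, add_zero, mul_smul_comm]
  | add p q hp hq =>
    simp only [map_add, LinearMap.add_apply, hp, hq]
    ring
  | mul_X p a hp =>
    have h : partialX n a ((∑ b, X b) * f) = (∑ b, X b) * partialX n a f + f := by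
      have h1 : pderiv a (∑ b, X b : Poly n) = 1 := by
        classical
        rw [map_sum, Finset.sum_eq_single a (fun b _ hb => pderiv_X_of_ne hb) (by simp),
          pderiv_X_self]
      simp only [partialX, Derivation.coeFn_coe, Derivation.leibniz, h1, smul_eq_mul, mul_one]
    rw [Derivation.leibniz, sumDeriv_X, map_mul (polyDiffHom n), polyDiffHom_X, Module.End.mul_apply, h, map_add,
      hp, Module.End.mul_apply, smul_eq_mul, smul_eq_mul, mul_one, map_add, LinearMap.add_apply,
      mul_comm (X a), map_mul (polyDiffHom n), polyDiffHom_X, Module.End.mul_apply]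
    ring

end Operators

/-! ### Alternating polynomials and the exponents of their monomials. -/

section Alternating

variable {n : ℕ}

theorem vdm_eq_det {R : Type*} [CommRing R] {m : ℕ} (v : Fin m → R) :
    vdm v = (Matrix.vandermonde v).det := (Matrix.det_vandermonde v).symm

theorem vdm_comp_perm {R : Type*} [CommRing R] {m : ℕ} (v : Fin m → R) (σ : Equiv.Perm (Fin m)) :
    vdm (v ∘ σ) = ((Equiv.Perm.sign σ : ℤ) : R) * vdm v := by
  rw [vdm_eq_det, vdm_eq_det, ← Matrix.det_permute]
  rfl

theorem map_vdm {R S : Type*} [CommRing R] [CommRing S] (φ : R →+* S) {m : ℕ} (v : Fin m → R) :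
    φ (vdm v) = vdm fun a => φ (v a) := by
  simp [vdm]

theorem vdm_eq_zero {R : Type*} [CommRing R] {m : ℕ} (v : Fin m → R)
    (h : ¬ Function.Injective v) : vdm v = 0 := by
  simp only [Function.Injective, not_forall] at h
  obtain ⟨a, b, hab, hne⟩ := h
  rw [vdm_eq_det]
  exact Matrix.det_zero_of_row_eq hne (by ext; simp [Matrix.vandermonde_apply, hab])

/-- The product of the Vandermonde determinant with a power of `∑ x_a`. -/
noncomputable def powVdm (n l : ℕ) : Poly n := (∑ a, X a) ^ l * vdm (X : Fin n → Poly n)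

theorem powVdm_zero : powVdm n 0 = vdm (X : Fin n → Poly n) := by
  rw [powVdm, pow_zero, one_mul]

theorem powVdm_succ (l : ℕ) : powVdm n (l + 1) = (∑ a, X a) * powVdm n l := by
  rw [powVdm, powVdm, pow_succ', mul_assoc]

theorem rename_swap_powVdm (l : ℕ) {i j : Fin n} (hij : i ≠ j) :
    rename (Equiv.swap i j) (powVdm n l) = -powVdm n l := by
  have h1 : rename (Equiv.swap i j) (∑ a, X a : Poly n) = ∑ a, X a := by
    simp only [map_sum, rename_X]
    exact Equiv.sum_comp (Equiv.swap i j) (fun a => (X a : Poly n))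
  have h2 : rename (Equiv.swap i j) (vdm (X : Fin n → Poly n)) = -vdm (X : Fin n → Poly n) := by
    have := map_vdm (rename (R := ℚ) (Equiv.swap i j)).toRingHom (X : Fin n → Poly n)
    simp only [AlgHom.toRingHom_eq_coe, RingHom.coe_coe, rename_X] at this
    rw [this]
    have h3 := vdm_comp_perm (X : Fin n → Poly n) (Equiv.swap i j)
    rw [Equiv.Perm.sign_swap hij] at h3
    simpa [Function.comp_def] using h3
  rw [powVdm, map_mul, map_pow, h1, h2, mul_neg]

/-- Swapping `i` and `j` fixes `ξ` but negates the polynomial, so the coefficient equals its own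
negative. -/
theorem coeff_powVdm_eq_zero (l : ℕ) (ξ : Fin n →₀ ℕ) {i j : Fin n} (hij : i ≠ j)
    (h : ξ i = ξ j) : coeff ξ (powVdm n l) = 0 := by
  have h1 := coeff_rename_mapDomain (Equiv.swap i j) (Equiv.injective _) (powVdm n l) ξ
  have h2 : Finsupp.mapDomain (Equiv.swap i j) ξ = ξ := by
    ext a
    rw [← Finsupp.equivMapDomain_eq_mapDomain, Finsupp.equivMapDomain_apply, Equiv.symm_swap]
    rcases eq_or_ne a i with rfl | hi
    · rw [Equiv.swap_apply_left, h]
    rcases eq_or_ne a j with rfl | hj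
    · rw [Equiv.swap_apply_right, h]
    rw [Equiv.swap_apply_of_ne_of_ne hi hj]
  rw [h2, rename_swap_powVdm l hij, coeff_neg] at h1
  linarith

theorem powVdm_isHomogeneous (l : ℕ) : (powVdm n l).IsHomogeneous (n.choose 2 + l) := by
  have h1 : (∑ a, X a : Poly n).IsHomogeneous 1 :=
    IsHomogeneous.sum _ _ _ fun a _ => isHomogeneous_X _ a
  have h2 : (vdm (X : Fin n → Poly n)).IsHomogeneous (n.choose 2) := by
    have := IsHomogeneous.prod Finset.univ
      (fun a : Fin n => ∏ b ∈ Finset.Ioi a, (X b - X a : Poly n))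
      (fun a => ∑ b ∈ Finset.Ioi a, 1) fun a _ => IsHomogeneous.prod _ _ _
        fun b _ => (isHomogeneous_X _ b).sub (isHomogeneous_X _ a)
    have hc : ∑ a : Fin n, ∑ b ∈ Finset.Ioi a, 1 = n.choose 2 := by
      simp only [Finset.sum_const, Fin.card_Ioi, smul_eq_mul, mul_one]
      rw [Fin.sum_univ_eq_sum_range (fun a => n - 1 - a),
        Finset.sum_range_reflect (fun a => a), Finset.sum_range_id, Nat.choose_two_right]
    rwa [hc] at this
  have := (h1.pow l).mul h2
  rwa [one_mul, add_comm] at this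

theorem injective_of_mem_support_powVdm (l : ℕ) (ξ : Fin n →₀ ℕ) (h : ξ ∈ (powVdm n l).support) :
    Function.Injective ξ := by
  intro i j hij
  by_contra hne
  exact (mem_support_iff.1 h) (coeff_powVdm_eq_zero l ξ hne hij)

theorem sum_of_mem_support_powVdm (l : ℕ) (ξ : Fin n →₀ ℕ) (h : ξ ∈ (powVdm n l).support) :
    ∑ a, ξ a = n.choose 2 + l := by
  have := (powVdm_isHomogeneous l) (mem_support_iff.1 h)
  rw [← this, Finsupp.weight_apply, Finsupp.sum_fintype _ _ (by simp)]
  simp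

end Alternating


/-! ### A lower bound for the degree of injective exponent vectors. -/

section Exponents

theorem choose_two_succ (k : ℕ) : (k + 1).choose 2 = k.choose 2 + k := by
  rw [Nat.choose_succ_succ' k 1, Nat.choose_one_right, add_comm]

/-- The extremal values are `c, c + 1, …`. In the induction the element with the largest value is
removed; that value is at least `c + k` when `k + 1` elements are present. -/
theorem card_mul_add_choose_le_sum {ι : Type*} (S : Finset ι) (f : ι → ℕ) (c : ℕ)
    (hf : Set.InjOn f S) (hc : ∀ a ∈ S, c ≤ f a) :
    S.card * c + S.card.choose 2 ≤ ∑ a ∈ S, f a := by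
  classical
  induction h : S.card generalizing S with
  | zero => simp
  | succ k ih =>
    obtain ⟨a, ha, hmax⟩ := S.exists_max_image f (Finset.card_pos.1 (by omega))
    have h1 := ih (S.erase a) (hf.mono (by simp))
      (fun b hb => hc b (Finset.mem_of_mem_erase hb)) (by rw [Finset.card_erase_of_mem ha, h]; rfl)
    have h2 : S.image f ⊆ Finset.Icc c (f a) := by
      intro x hx
      obtain ⟨b, hb, rfl⟩ := Finset.mem_image.1 hx
      exact Finset.mem_Icc.2 ⟨hc b hb, hmax b hb⟩
    have h3 := Finset.card_le_card h2
    rw [Finset.card_image_of_injOn hf, h, Nat.card_Icc] at h3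
    rw [← Finset.add_sum_erase S f ha, choose_two_succ]
    have : (k + 1) * c = k * c + c := by ring
    lia

variable {n s : ℕ}

/-- The exponents of a product of linear forms: on the image of `b` they are given by a
permutation `σ` of `0, …, s - 1`, elsewhere they are `s`, and those in `T` are increased by one. -/
noncomputable def hookExponent (b : Fin s → Fin n) (σ : Equiv.Perm (Fin s))
    (T : Finset (Fin n)) (a : Fin n) : ℕ :=
  open Classical in
  (if h : ∃ v, b v = a then (σ h.choose : ℕ) else s) + if a ∈ T then 1 else 0

theorem hookExponent_apply {b : Fin s → Fin n} (hb : Function.Injective b)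
    (σ : Equiv.Perm (Fin s)) (T : Finset (Fin n)) (v : Fin s) :
    hookExponent b σ T (b v) = σ v + if b v ∈ T then 1 else 0 := by
  have h : ∃ w, b w = b v := ⟨v, rfl⟩
  have h2 : h.choose = v := hb h.choose_spec
  rw [hookExponent, dif_pos h, h2]

theorem hookExponent_of_notMem {b : Fin s → Fin n} (σ : Equiv.Perm (Fin s)) (T : Finset (Fin n))
    {a : Fin n} (ha : a ∉ Finset.univ.image b) :
    hookExponent b σ T a = s + if a ∈ T then 1 else 0 := by
  have h : ¬ ∃ w, b w = a := by simpa using ha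
  rw [hookExponent, dif_neg h]

theorem sum_val_perm (σ : Equiv.Perm (Fin s)) : ∑ v, (σ v : ℕ) = s.choose 2 := by
  rw [Equiv.sum_comp σ (fun v => (v : ℕ)), Fin.sum_univ_eq_sum_range (fun v => v),
    Finset.sum_range_id, Nat.choose_two_right]

theorem card_compl_image {b : Fin s → Fin n} (hb : Function.Injective b) :
    (Finset.univ.image b)ᶜ.card = n - s := by
  rw [Finset.card_compl, Finset.card_image_of_injective _ hb, Finset.card_univ, Fintype.card_fin,
    Fintype.card_fin]

theorem sum_eq_sum_add_sum_compl {M : Type*} [AddCommMonoid M] {b : Fin s → Fin n}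
    (hb : Function.Injective b) (f : Fin n → M) :
    ∑ a, f a = ∑ v, f (b v) + ∑ a ∈ (Finset.univ.image b)ᶜ, f a := by
  rw [← Finset.sum_add_sum_compl (Finset.univ.image b) f, Finset.sum_image fun x _ y _ h => hb h]

theorem sum_hookExponent {b : Fin s → Fin n} (hb : Function.Injective b)
    (σ : Equiv.Perm (Fin s)) (T : Finset (Fin n)) :
    ∑ a, hookExponent b σ T a = s.choose 2 + (n - s) * s + T.card := by
  have h1 : T.card = ∑ a, if a ∈ T then 1 else 0 := by simp
  rw [h1, sum_eq_sum_add_sum_compl hb, sum_eq_sum_add_sum_compl hb (fun a => if a ∈ T then 1 else 0),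
    Finset.sum_congr rfl (fun v _ => hookExponent_apply hb σ T v),
    Finset.sum_congr rfl (fun a ha => hookExponent_of_notMem σ T (Finset.mem_compl.1 ha)),
    Finset.sum_add_distrib, Finset.sum_add_distrib, sum_val_perm, Finset.sum_const,
    card_compl_image hb, smul_eq_mul]
  ring

theorem choose_two_add (a b : ℕ) : (a + b).choose 2 = a.choose 2 + b.choose 2 + a * b := by
  induction b with
  | zero => simp
  | succ b ih =>
    rw [← add_assoc, choose_two_succ, choose_two_succ, ih]
    ring

/-- An injective exponent vector dominating `hookExponent` has large degree. -/
theorem choose_add_le_sum_of_hookExponent_le (hs : s ≤ n) {b : Fin s → Fin n}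
    (hb : Function.Injective b) (σ : Equiv.Perm (Fin s)) (T : Finset (Fin n))
    (hT : T.card = n - s) (ξ : Fin n → ℕ) (hξ : Function.Injective ξ)
    (h : ∀ a, hookExponent b σ T a ≤ ξ a) : n.choose 2 + (n - s) ≤ ∑ a, ξ a := by
  classical
  obtain ⟨m, rfl⟩ := Nat.exists_eq_add_of_le hs
  have hm : s + m - s = m := by omega
  have hE := card_compl_image hb
  rw [hm] at hE hT ⊢
  set E := (Finset.univ.image b)ᶜ with hEdef
  have hbE (v : Fin s) : b v ∉ E := by simp [hEdef]
  rw [sum_eq_sum_add_sum_compl hb, choose_two_add, ← hEdef]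
  have hout : ∀ a ∈ E, s + (if a ∈ T then 1 else 0) ≤ ξ a := fun a ha => by
    rw [← hookExponent_of_notMem σ T (Finset.mem_compl.1 ha)]; exact h a
  have hin : ∀ v, σ v + (if b v ∈ T then 1 else 0) ≤ ξ (b v) := fun v => by
    rw [← hookExponent_apply hb σ T]; exact h _
  -- If some value on the image of `b` reaches `s`, then `m + 1` distinct values are at least `s`,
  -- which alone exceeds the bound by one. Otherwise the values on the image are exactly `0, …, s -
  -- 1`.
  by_cases hlarge : ∃ v, s ≤ ξ (b v)
  · obtain ⟨v, hv⟩ := hlarge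
    have h1 := card_mul_add_choose_le_sum (insert (b v) E) ξ s hξ.injOn (by
      intro a ha
      rcases Finset.mem_insert.1 ha with rfl | ha
      · exact hv
      · exact le_trans (Nat.le_add_right _ _) (hout a ha))
    have h2 := card_mul_add_choose_le_sum (Finset.univ.erase v) (fun w => ξ (b w)) 0
      (hξ.comp hb).injOn (by simp)
    rw [Finset.card_insert_of_notMem (hbE v), Finset.sum_insert (hbE v), hE] at h1
    rw [Finset.card_erase_of_mem (Finset.mem_univ v), Finset.card_univ, Fintype.card_fin] at h2
    rw [← Finset.add_sum_erase Finset.univ (fun w => ξ (b w)) (Finset.mem_univ v)]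
    obtain ⟨r, rfl⟩ : ∃ r, s = r + 1 := ⟨s - 1, by have := v.isLt; omega⟩
    rw [choose_two_succ] at h1 ⊢
    simp only [Nat.add_sub_cancel, mul_zero, zero_add] at h1 h2 ⊢
    have e1 : (m + 1) * (r + 1) = (r + 1) * m + r + 1 := by ring
    omega
  · simp only [not_exists, not_le] at hlarge
    have hperm : Function.Bijective fun v => (⟨ξ (b v), hlarge v⟩ : Fin s) :=
      Finite.injective_iff_bijective.1 fun v w hvw => hb (hξ (Fin.mk.inj_iff.1 hvw))
    have hsum : ∑ v, ξ (b v) = s.choose 2 := sum_val_perm (Equiv.ofBijective _ hperm)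
    -- Domination leaves no slack on the image, so `T` avoids it and by cardinality is its
    -- complement, where all values are then at least `s + 1`.
    have hTb : ∀ v, b v ∉ T := by
      have h3 : ∑ v, ((σ v : ℕ) + if b v ∈ T then 1 else 0) ≤ ∑ v, ξ (b v) :=
        Finset.sum_le_sum fun v _ => hin v
      rw [Finset.sum_add_distrib, sum_val_perm, hsum] at h3
      have h4 : ∑ v, (if b v ∈ T then 1 else 0) = 0 := by omega
      intro v hv
      have := Finset.sum_eq_zero_iff.1 h4 v (Finset.mem_univ v)
      simp [hv] at this
    have hTE : T = E := by
      apply Finset.eq_of_subset_of_card_le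
      · intro a ha
        rw [hEdef, Finset.mem_compl, Finset.mem_image]
        rintro ⟨v, _, rfl⟩
        exact hTb v ha
      · omega
    have h5 := card_mul_add_choose_le_sum E ξ (s + 1) hξ.injOn fun a ha => by
      have := hout a ha
      rwa [hTE, if_pos ha] at this
    rw [hE] at h5
    have e1 : m * (s + 1) = s * m + m := by ring
    omega

end Exponents

/-! ### Products of linear factors and descent along their coefficients. -/

section LinearFactors

variable {n : ℕ}

/-- The linear factor `1 - q x_a`. -/
noncomputable def linFactor {R : Type*} [CommRing R] (x : R) : Polynomial R :=
  1 - Polynomial.C x * Polynomial.X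

theorem map_linFactor {R S : Type*} [CommRing R] [CommRing S] (φ : R →+* S) (x : R) :
    (linFactor x).map φ = linFactor (φ x) := by
  simp [linFactor]

theorem coeff_linFactor_mul_succ {R : Type*} [CommRing R] (x : R) (Y : Polynomial R) (p : ℕ) :
    (linFactor x * Y).coeff (p + 1) = Y.coeff (p + 1) - x * Y.coeff p := by
  rw [linFactor, sub_mul, one_mul, mul_assoc, Polynomial.coeff_sub, Polynomial.coeff_C_mul,
    Polynomial.coeff_X_mul]

theorem coeff_linFactor_mul_zero {R : Type*} [CommRing R] (x : R) (Y : Polynomial R) :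
    (linFactor x * Y).coeff 0 = Y.coeff 0 := by
  simp [linFactor, sub_mul, mul_assoc]

/-- The coefficients of a product of `e` linear factors, with leading coefficient `g`, are
related by the derivation `sumDeriv`. -/
structure IsLinearProduct (Y : Polynomial (Poly n)) (e : ℕ) (g : Poly n) : Prop where
  natDegree_le : Y.natDegree ≤ e
  coeff_top : Y.coeff e = g
  deriv_zero : sumDeriv n (Y.coeff 0) = 0
  deriv_succ : ∀ p, sumDeriv n (Y.coeff (p + 1)) = ((p : Poly n) - e) * Y.coeff p

theorem IsLinearProduct.one : IsLinearProduct (1 : Polynomial (Poly n)) 0 1 where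
  natDegree_le := by simp
  coeff_top := by simp
  deriv_zero := by simp
  deriv_succ p := by
    rcases p with _ | p <;> simp [Polynomial.coeff_one]

/-- With `D = sumDeriv n`, the derivative conditions say `D Y = -(e q - q² d/dq) Y`. Such relations
add under products, and for a single factor `1 - q x_a` both sides are `-q`. -/
theorem IsLinearProduct.linFactor_mul {Y : Polynomial (Poly n)} {e : ℕ} {g : Poly n}
    (h : IsLinearProduct Y e g) (a : Fin n) :
    IsLinearProduct (linFactor (X a) * Y) (e + 1) (-X a * g) where
  natDegree_le := by
    refine Polynomial.natDegree_mul_le.trans ?_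
    have h1 : (linFactor (X a : Poly n)).natDegree ≤ 1 := by
      rw [linFactor]
      compute_degree
    have := h.natDegree_le
    omega
  coeff_top := by
    rw [coeff_linFactor_mul_succ, h.coeff_top,
      Polynomial.coeff_eq_zero_of_natDegree_lt (Nat.lt_succ_of_le h.natDegree_le)]
    ring
  deriv_zero := by rw [coeff_linFactor_mul_zero, h.deriv_zero]
  deriv_succ p := by
    rw [coeff_linFactor_mul_succ, map_sub, h.deriv_succ, Derivation.leibniz, sumDeriv_X]
    rcases p with _ | p
    · rw [coeff_linFactor_mul_zero, h.deriv_zero]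
      simp only [smul_eq_mul]
      push_cast
      ring
    · rw [coeff_linFactor_mul_succ, h.deriv_succ]
      simp only [smul_eq_mul]
      push_cast
      ring

theorem IsLinearProduct.pow_mul {Y : Polynomial (Poly n)} {e : ℕ} {g : Poly n}
    (h : IsLinearProduct Y e g) (a : Fin n) (k : ℕ) :
    IsLinearProduct (linFactor (X a) ^ k * Y) (k + e) ((-X a) ^ k * g) := by
  induction k with
  | zero => simpa using h
  | succ k ih =>
    have := ih.linFactor_mul a
    rwa [← mul_assoc, ← mul_assoc, ← pow_succ', ← pow_succ',
      show k + e + 1 = k + 1 + e by ring] at this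

theorem isLinearProduct_prod (μ : Fin n → ℕ) :
    IsLinearProduct (∏ a, linFactor (X a : Poly n) ^ μ a) (∑ a, μ a) (∏ a, (-X a) ^ μ a) := by
  classical
  induction (Finset.univ : Finset (Fin n)) using Finset.induction_on with
  | empty => simpa using IsLinearProduct.one
  | insert a S ha ih =>
    rw [Finset.prod_insert ha, Finset.prod_insert ha, Finset.sum_insert ha]
    exact ih.pow_mul a (μ a)

/-- Descending induction from the leading coefficient: if the coefficient of index `p + 1` kills two
consecutive `powVdm`, then by `polyDiffHom_sum_X_mul` its `sumDeriv` kills the first of them, and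
this is a nonzero multiple of the coefficient of index `p`. Each descent costs one power of `∑ x_a`,
whence `m` steps are available. -/
theorem IsLinearProduct.polyDiffHom_coeff {Y : Polynomial (Poly n)} {e : ℕ} {g : Poly n}
    (h : IsLinearProduct Y e g) {m : ℕ} (hg : ∀ l < m, polyDiffHom n g (powVdm n l) = 0)
    {p : ℕ} (hp : e < p + m) : polyDiffHom n (Y.coeff p) (powVdm n 0) = 0 := by
  have key : ∀ l p l', p + l = e → l + l' < m →
      polyDiffHom n (Y.coeff p) (powVdm n l') = 0 := by
    intro l
    induction l with
    | zero =>
      intro p l' hp hl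
      rw [add_zero] at hp
      rw [hp, h.coeff_top]
      exact hg _ (by omega)
    | succ l ih =>
      intro p l' hp hl
      have h1 := polyDiffHom_sum_X_mul (Y.coeff (p + 1)) (powVdm n l')
      rw [← powVdm_succ, ih (p + 1) (l' + 1) (by omega) (by omega),
        ih (p + 1) l' (by omega) (by omega), mul_zero, zero_add, h.deriv_succ] at h1
      have h2 : ((p : Poly n) - e) * Y.coeff p = (-((l : ℚ) + 1)) • Y.coeff p := by
        rw [← hp, Algebra.smul_def]
        simp
      rw [h2, map_smul, LinearMap.smul_apply] at h1
      refine (smul_eq_zero.1 h1.symm).resolve_left ?_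
      have : (0 : ℚ) < (l : ℚ) + 1 := by positivity
      linarith
  by_cases hpe : p ≤ e
  · exact key (e - p) p 0 (by omega) (by omega)
  · rw [Polynomial.coeff_eq_zero_of_natDegree_lt (lt_of_le_of_lt h.natDegree_le (not_le.1 hpe)),
      map_zero, LinearMap.zero_apply]

/-- The product of the other `n - 1` factors inverts `1 - q x_a`, so it is the geometric series in
`q x_a`; yet its degree in `q` is below `n`. -/
theorem pow_eq_zero_of_prod_linFactor_eq_one {R : Type*} [CommRing R] {x : Fin n → R}
    (h : ∏ a, linFactor (x a) = 1) (a : Fin n) : x a ^ n = 0 := by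
  classical
  rw [← Finset.mul_prod_erase _ _ (Finset.mem_univ a)] at h
  set W := ∏ c ∈ Finset.univ.erase a, linFactor (x c) with hW
  have hc : ∀ p, W.coeff p = x a ^ p := by
    intro p
    induction p with
    | zero => rw [← coeff_linFactor_mul_zero (x a), h]; simp
    | succ p ih =>
      have h1 := coeff_linFactor_mul_succ (x a) W p
      rw [h, Polynomial.coeff_one, if_neg (Nat.succ_ne_zero p)] at h1
      rw [pow_succ', ← ih]
      exact (sub_eq_zero.1 h1.symm)
  rw [← hc]
  apply Polynomial.coeff_eq_zero_of_natDegree_lt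
  refine lt_of_le_of_lt (Polynomial.natDegree_prod_le _ _) ?_
  refine lt_of_le_of_lt (Finset.sum_le_card_nsmul _ _ 1 fun c _ => ?_) ?_
  · rw [linFactor]
    compute_degree
  · rw [Finset.card_erase_of_mem (Finset.mem_univ a), Finset.card_univ, Fintype.card_fin,
      smul_eq_mul, mul_one]
    have := a.isLt
    omega

end LinearFactors

/-! ### The annihilator of the Vandermonde product and the quotient by it. -/

section Annihilator

variable {n s : ℕ}

/-- The ideal of polynomials whose differential operators annihilate the Vandermonde product. -/
noncomputable def vdmAnnihilator (n : ℕ) : Ideal (Poly n) where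
  carrier := {g | polyDiffHom n g (vdm (X : Fin n → Poly n)) = 0}
  add_mem' {f g} hf hg := by
    simp only [Set.mem_ofPred_eq] at hf hg ⊢
    rw [map_add, LinearMap.add_apply, hf, hg, add_zero]
  zero_mem' := by simp
  smul_mem' c g hg := by
    simp only [Set.mem_ofPred_eq] at hg ⊢
    rw [smul_eq_mul, map_mul, Module.End.mul_apply, hg, map_zero]

theorem mem_vdmAnnihilator {g : Poly n} :
    g ∈ vdmAnnihilator n ↔ polyDiffHom n g (vdm (X : Fin n → Poly n)) = 0 := Iff.rfl

theorem coeff_prod_linFactor_hookExponent_mem (hs : s ≤ n) {b : Fin s → Fin n}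
    (hb : Function.Injective b) (σ : Equiv.Perm (Fin s)) (T : Finset (Fin n))
    (hT : T.card = n - s) {p : ℕ} (hp : s.choose 2 + (n - s) * s < p) :
    (∏ a, linFactor (X a : Poly n) ^ hookExponent b σ T a).coeff p ∈ vdmAnnihilator n := by
  rw [mem_vdmAnnihilator, ← powVdm_zero]
  refine (isLinearProduct_prod (hookExponent b σ T)).polyDiffHom_coeff (m := n - s) ?_ ?_
  · intro l hl
    have h1 : ∏ a, (-X a : Poly n) ^ hookExponent b σ T a =
        (∏ a, (-1 : Poly n) ^ hookExponent b σ T a) * ∏ a, X a ^ hookExponent b σ T a := by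
      rw [← Finset.prod_mul_distrib]
      exact Finset.prod_congr rfl fun a _ => neg_pow _ _
    rw [h1, map_mul, Module.End.mul_apply, polyDiffHom_prod_X_pow_eq_zero, map_zero]
    intro ξ hξ
    by_contra! hcon
    have h2 := choose_add_le_sum_of_hookExponent_le hs hb σ T hT ξ
      (injective_of_mem_support_powVdm l ξ hξ) hcon
    rw [sum_of_mem_support_powVdm l ξ hξ] at h2
    omega
  · rw [sum_hookExponent hb, hT]
    omega

/-- The projection to the quotient of the polynomial ring by the annihilator of the Vandermonde
product. -/
noncomputable abbrev coinvMk (n : ℕ) : Poly n →ₐ[ℚ] Poly n ⧸ vdmAnnihilator n :=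
  Ideal.Quotient.mkₐ ℚ (vdmAnnihilator n)

theorem map_prod_linFactor {R : Type*} [CommRing R] (φ : Poly n →+* R) (μ : Fin n → ℕ) :
    (∏ a, linFactor (X a : Poly n) ^ μ a).map φ = ∏ a, linFactor (φ (X a)) ^ μ a := by
  simp only [Polynomial.map_prod, Polynomial.map_pow, map_linFactor]

theorem coeff_prod_linFactor_coinvMk (hs : s ≤ n) {b : Fin s → Fin n}
    (hb : Function.Injective b) (σ : Equiv.Perm (Fin s)) (T : Finset (Fin n))
    (hT : T.card = n - s) {p : ℕ} (hp : s.choose 2 + (n - s) * s < p) :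
    (∏ a, linFactor (coinvMk n (X a)) ^ hookExponent b σ T a).coeff p = 0 := by
  have h := map_prod_linFactor (coinvMk n).toRingHom (hookExponent b σ T)
  simp only [AlgHom.toRingHom_eq_coe, RingHom.coe_coe] at h
  rw [← h, Polynomial.coeff_map]
  exact Ideal.Quotient.eq_zero_iff_mem.2 (coeff_prod_linFactor_hookExponent_mem hs hb σ T hT hp)

/-- The case `s = 0` of the previous vanishing: with `T` the whole index set all exponents are one,
and every positive power of `q` is beyond the bound `0`. -/
theorem prod_linFactor_coinvMk : ∏ a : Fin n, linFactor (coinvMk n (X a)) = 1 := by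
  have hb : Function.Injective (Fin.elim0 : Fin 0 → Fin n) := fun a => a.elim0
  have h (a : Fin n) : hookExponent (Fin.elim0 : Fin 0 → Fin n) 1 Finset.univ a = 1 := by
    rw [hookExponent_of_notMem] <;> simp
  ext p
  rcases p with _ | p
  · simp only [Polynomial.coeff_zero_prod]
    simp [linFactor]
  · have := coeff_prod_linFactor_coinvMk (Nat.zero_le n) hb 1 Finset.univ (by simp)
      (p := p + 1) (by simp)
    simp only [h, pow_one] at this
    rw [this, Polynomial.coeff_one, if_neg (Nat.succ_ne_zero p)]

end Annihilator

end HarmonicForms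

namespace HarmonicForms

/-! ### Vandermonde numbers as binomial determinants. -/

section ChooseDeterminant

variable {A : Type*} [CommRing A] {n s : ℕ}

theorem one_sub_mul_sum_choose_zero {z : A} (hz : z ^ n = 0) :
    (1 - z) * ∑ j ∈ Finset.range n, (j.choose 0 : A) * z ^ j = 1 := by
  simp only [Nat.choose_zero_right, Nat.cast_one, one_mul]
  rw [mul_neg_geom_sum, hz, sub_zero]

theorem one_sub_mul_sum_choose_succ {z : A} (hz : z ^ n = 0) (i : ℕ) :
    (1 - z) * ∑ j ∈ Finset.range n, (j.choose (i + 1) : A) * z ^ j =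
      z * ∑ j ∈ Finset.range n, (j.choose i : A) * z ^ j := by
  have key : ∀ k : ℕ, (1 - z) * ∑ j ∈ Finset.range k, (j.choose (i + 1) : A) * z ^ j =
      z * ∑ j ∈ Finset.range k, (j.choose i : A) * z ^ j - (k.choose (i + 1) : A) * z ^ k := by
    intro k
    induction k with
    | zero => simp
    | succ k ih =>
      rw [Finset.sum_range_succ, Finset.sum_range_succ, mul_add, ih, Nat.choose_succ_succ']
      push_cast
      ring
  rw [key, hz, mul_zero, sub_zero]

theorem sum_choose_mul_pow {z w : A} (hz : z ^ n = 0) (hw : w * (1 - z) = 1) (i : ℕ) :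
    ∑ j ∈ Finset.range n, (j.choose i : A) * z ^ j = w * (z * w) ^ i := by
  induction i with
  | zero =>
    rw [pow_zero, mul_one, ← mul_one w, ← one_sub_mul_sum_choose_zero hz, ← mul_assoc, hw, one_mul]
  | succ i ih =>
    calc _ = w * ((1 - z) * ∑ j ∈ Finset.range n, (j.choose (i + 1) : A) * z ^ j) := by
          rw [← mul_assoc, hw, one_mul]
      _ = _ := by rw [one_sub_mul_sum_choose_succ hz, ih]; ring

/-- Summing each row turns the left side into the determinant of `w_v (z_v w_v)^i`. As `z_v w_v =
w_v - 1`, translation invariance of the Vandermonde determinant replaces this by `w_v^(i+1)`, and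
extracting `w_v^s` from each row leaves `(1 - z_v)^(s-1-i)`. -/
theorem sum_det_choose_mul_prod_pow {z w : Fin s → A} (hz : ∀ v, z v ^ n = 0)
    (hw : ∀ v, w v * (1 - z v) = 1) :
    ∑ j ∈ Fintype.piFinset fun _ : Fin s => Finset.range n,
        (Matrix.of fun v i : Fin s => ((j v).choose i : A)).det * ∏ v, z v ^ j v =
      (∏ v, w v) ^ s * ∑ τ : Equiv.Perm (Fin s),
        ((Equiv.Perm.sign τ : ℤ) : A) * ∏ v, (1 - z v) ^ (Fin.rev (τ v) : ℕ) := by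
  have h1 : ∑ j ∈ Fintype.piFinset fun _ : Fin s => Finset.range n,
        (Matrix.of fun v i : Fin s => ((j v).choose i : A)).det * ∏ v, z v ^ j v =
      (Matrix.of fun v i : Fin s => w v * (z v * w v) ^ (i : ℕ)).det := by
    rw [← Matrix.det_transpose, Matrix.det_apply']
    simp only [Matrix.transpose_apply, Matrix.of_apply, ← sum_choose_mul_pow (hz _) (hw _)]
    simp only [Finset.prod_univ_sum, Finset.mul_sum]
    rw [Finset.sum_comm]
    refine Finset.sum_congr rfl fun j _ => ?_
    rw [← Matrix.det_transpose, Matrix.det_apply', Finset.sum_mul]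
    refine Finset.sum_congr rfl fun τ _ => ?_
    rw [mul_assoc, ← Finset.prod_mul_distrib]
    rfl
  have h2 : (Matrix.of fun v i : Fin s => w v * (z v * w v) ^ (i : ℕ)).det =
      (∏ v, w v) * (Matrix.vandermonde w).det := by
    rw [← Matrix.det_vandermonde_sub w 1, ← Matrix.det_mul_column]
    congr 1
    ext v i
    simp only [Matrix.of_apply, Matrix.vandermonde_apply]
    congr 2
    linear_combination -(hw v)
  have h3 : (∏ v, w v) * (Matrix.vandermonde w).det = (∏ v, w v) ^ s *
      (Matrix.of fun v i : Fin s => (1 - z v) ^ (Fin.rev i : ℕ)).det := by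
    rw [← Finset.prod_pow, ← Matrix.det_mul_column, ← Matrix.det_mul_column]
    congr 1
    ext v i
    simp only [Matrix.of_apply, Matrix.vandermonde_apply]
    have h4 : s = (i : ℕ) + 1 + (Fin.rev i : ℕ) := by
      rw [Fin.val_rev]; have := i.isLt; omega
    calc w v * w v ^ (i : ℕ) = w v ^ ((i : ℕ) + 1) * (w v * (1 - z v)) ^ (Fin.rev i : ℕ) := by
          rw [hw, one_pow]; ring
      _ = w v ^ ((i : ℕ) + 1 + (Fin.rev i : ℕ)) * (1 - z v) ^ (Fin.rev i : ℕ) := by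
          rw [mul_pow]; ring
      _ = _ := by rw [← h4]
  rw [h1, h2, h3, ← Matrix.det_transpose, Matrix.det_apply']
  rfl

/-- The falling factorials are monic of degree `i`, so they may replace the powers in the
Vandermonde determinant. -/
theorem vdm_natCast (j : Fin s → ℕ) :
    vdm (fun v => (j v : ℚ)) =
      (∏ i : Fin s, ((i : ℕ).factorial : ℚ)) *
        (Matrix.of fun v i : Fin s => ((j v).choose i : ℚ)).det := by
  rw [vdm_eq_det, Matrix.det_eval_matrixOfPolynomials_eq_det_vandermonde _
    (fun i => descPochhammer ℚ i) (fun i => descPochhammer_natDegree ℚ i)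
    (fun i => monic_descPochhammer ℚ i), ← Matrix.det_mul_row]
  congr 1
  ext v i
  simp only [Matrix.of_apply]
  rw [descPochhammer_eval_eq_descFactorial, Nat.descFactorial_eq_factorial_mul_choose]
  push_cast
  rfl

end ChooseDeterminant

/-! ### The generating function of the relations modulo the annihilator. -/

section GeneratingFunction

variable {n s : ℕ} {R : Type*} [CommRing R]

theorem prod_linFactor_pow_hookExponent {b : Fin s → Fin n} (hb : Function.Injective b)
    (σ : Equiv.Perm (Fin s)) (T : Finset (Fin n)) (x : Fin n → R) :
    ∏ a, linFactor (x a) ^ hookExponent b σ T a =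
      (∏ v, linFactor (x (b v)) ^ (σ v : ℕ)) *
        (∏ a ∈ (Finset.univ.image b)ᶜ, linFactor (x a)) ^ s *
        ∏ a ∈ T, linFactor (x a) := by
  classical
  have h (a : Fin n) : hookExponent b σ T a =
      hookExponent b σ ∅ a + if a ∈ T then 1 else 0 := by
    simp [hookExponent]
  have h1 : ∏ a, linFactor (x a) ^ hookExponent b σ ∅ a =
      (∏ v, linFactor (x (b v)) ^ (σ v : ℕ)) *
        (∏ a ∈ (Finset.univ.image b)ᶜ, linFactor (x a)) ^ s := by
    rw [← Finset.prod_mul_prod_compl (Finset.univ.image b),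
      Finset.prod_image fun x _ y _ h => hb h, ← Finset.prod_pow]
    congr 1
    · refine Finset.prod_congr rfl fun v _ => ?_
      rw [hookExponent_apply hb]
      simp
    · refine Finset.prod_congr rfl fun a ha => ?_
      rw [hookExponent_of_notMem σ ∅ (Finset.mem_compl.1 ha)]
      simp
  rw [← h1]
  simp only [h, pow_add, Finset.prod_mul_distrib, pow_ite, pow_one, pow_zero]
  rw [Finset.prod_ite_mem, Finset.univ_inter]

theorem sum_vdm_smul_prod_pow [Algebra ℚ R] {b : Fin s → Fin n} (hb : Function.Injective b)
    {x : Fin n → R} (hx : ∏ a, linFactor (x a) = 1) :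
    ∑ j ∈ Fintype.piFinset fun _ : Fin s => Finset.range n,
        vdm (fun v => (j v : ℚ)) •
          ∏ v, (Polynomial.C (x (b v)) * Polynomial.X) ^ j v =
      (∏ i : Fin s, ((i : ℕ).factorial : ℚ)) • ∑ τ : Equiv.Perm (Fin s),
        (((Equiv.Perm.sign τ : ℤ) : Polynomial (R)) *
          ∏ a, linFactor (x a) ^ hookExponent b (τ.trans Fin.revPerm) ∅ a) := by
  classical
  set z : Fin s → Polynomial (R) := fun v =>
    Polynomial.C (x (b v)) * Polynomial.X with hzdef
  set w : Fin s → Polynomial (R) := fun v =>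
    ∏ a ∈ Finset.univ.erase (b v), linFactor (x a) with hwdef
  have hz : ∀ v, z v ^ n = 0 := fun v => by
    rw [hzdef]
    simp only [mul_pow, ← Polynomial.C_pow, pow_eq_zero_of_prod_linFactor_eq_one hx, Polynomial.C_0, zero_mul]
  have hw : ∀ v, w v * (1 - z v) = 1 := fun v => by
    exact (Finset.prod_erase_mul _ _ (Finset.mem_univ (b v))).trans hx
  have hW : ∏ v, w v = ∏ a ∈ (Finset.univ.image b)ᶜ, linFactor (x a) := by
    have h1 : (∏ v, w v) * ∏ v, (1 - z v) = 1 := by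
      rw [← Finset.prod_mul_distrib]
      exact Finset.prod_eq_one fun v _ => hw v
    have h2 : (∏ v, (1 - z v)) * ∏ a ∈ (Finset.univ.image b)ᶜ, linFactor (x a) = 1 := by
      have h3 := hx
      rw [← Finset.prod_mul_prod_compl (Finset.univ.image b),
        Finset.prod_image fun x _ y _ h => hb h] at h3
      exact h3
    -- Both sides invert `∏ (1 - z_v)`.
    exact left_inv_eq_right_inv h1 h2
  have key := sum_det_choose_mul_prod_pow hz hw
  have h3 : ∀ j : Fin s → ℕ, vdm (fun v => (j v : ℚ)) • ∏ v, z v ^ j v =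
      (∏ i : Fin s, ((i : ℕ).factorial : ℚ)) •
        ((Matrix.of fun v i : Fin s => ((j v).choose i : Polynomial (R))).det *
          ∏ v, z v ^ j v) := fun j => by
    have h4 : (Matrix.of fun v i : Fin s => ((j v).choose i : Polynomial (R))).det =
        algebraMap ℚ _ (Matrix.of fun v i : Fin s => ((j v).choose i : ℚ)).det := by
      rw [RingHom.map_det]
      congr 1
      ext v i
      simp
    rw [vdm_natCast, h4, mul_smul, ← Algebra.smul_def]
  rw [Finset.sum_congr rfl fun j _ => h3 j, ← Finset.smul_sum, key, hW, Finset.mul_sum]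
  congr 1
  refine Finset.sum_congr rfl fun τ _ => ?_
  rw [prod_linFactor_pow_hookExponent hb, Finset.prod_empty, mul_one, mul_left_comm]
  congr 1
  rw [mul_comm]
  rfl

/-- The sum of the products of `m` distinct factors `1 - q x_a` among the first `N`. -/
noncomputable def linFactorSum (n N m : ℕ) : Polynomial (Poly n) :=
  ∑ T ∈ Finset.powersetCard m {a : Fin n | (a : ℕ) < N},
    ∏ a ∈ T, linFactor (MvPolynomial.X a : Poly n)

theorem card_filter_subset_powersetCard {α : Type*} [DecidableEq α] {S U : Finset α} (h : S ⊆ U)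
    {m : ℕ} (hm : S.card ≤ m) :
    {T ∈ Finset.powersetCard m U | S ⊆ T}.card = (U.card - S.card).choose (m - S.card) := by
  rw [← Finset.card_sdiff_of_subset h, ← Finset.card_powersetCard]
  refine Finset.card_nbij' (fun T => T \ S) (fun T => T ∪ S) ?_ ?_ ?_ ?_
  · intro T hT
    simp only [Finset.coe_filter, Finset.mem_powersetCard, Set.mem_ofPred_eq] at hT
    simp only [Finset.mem_coe, Finset.mem_powersetCard]
    exact ⟨Finset.sdiff_subset_sdiff hT.1.1 le_rfl, by
      rw [Finset.card_sdiff_of_subset hT.2, hT.1.2]⟩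
  · intro T hT
    simp only [Finset.mem_coe, Finset.mem_powersetCard, Finset.subset_sdiff] at hT
    simp only [Finset.coe_filter, Finset.mem_powersetCard, Set.mem_ofPred_eq]
    refine ⟨⟨Finset.union_subset hT.1.1 h, ?_⟩, Finset.subset_union_right⟩
    rw [Finset.card_union_of_disjoint hT.1.2, hT.2]
    omega
  · intro T hT
    simp only [Finset.coe_filter, Set.mem_ofPred_eq] at hT
    exact Finset.sdiff_union_of_subset hT.2
  · intro T hT
    simp only [Finset.mem_coe, Finset.mem_powersetCard, Finset.subset_sdiff] at hT
    simp only
    rw [Finset.union_sdiff_right, Finset.sdiff_eq_self_of_disjoint hT.1.2]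

theorem prod_linFactor_eq_sum (T : Finset (Fin n)) :
    ∏ a ∈ T, linFactor (MvPolynomial.X a : Poly n) =
      ∑ S ∈ T.powerset, Polynomial.C ((-1) ^ S.card * ∏ a ∈ S, MvPolynomial.X a) *
        Polynomial.X ^ S.card := by
  have h (a : Fin n) : linFactor (MvPolynomial.X a : Poly n) =
      1 + Polynomial.C (-MvPolynomial.X a) * Polynomial.X := by
    rw [linFactor, Polynomial.C_neg]; ring
  simp only [h, Finset.prod_one_add]
  refine Finset.sum_congr rfl fun S _ => ?_
  rw [Finset.prod_mul_distrib, Finset.prod_const, ← map_prod, Finset.prod_neg]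

/-- Each `r`-subset of the first `N` indices lies in `(N-r).choose (m-r)` of the sets `T`. -/
theorem coeff_linFactorSum {N m r : ℕ} (hN : N ≤ n) (hr : r ≤ m) :
    (linFactorSum n N m).coeff r =
      (((-1 : ℚ) ^ r) * ((N - r).choose (m - r) : ℚ)) • elemSymm n N r := by
  classical
  set U : Finset (Fin n) := {a : Fin n | (a : ℕ) < N} with hU
  have hUc : U.card = N := by
    rw [hU, Fin.card_filter_val_lt, min_eq_right hN]
  have h1 : (linFactorSum n N m).coeff r = ∑ T ∈ Finset.powersetCard m U,
      ∑ S ∈ Finset.powersetCard r U, if S ⊆ T then (-1) ^ r * ∏ a ∈ S, MvPolynomial.X a else 0 := by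
    rw [linFactorSum, Polynomial.finsetSum_coeff]
    refine Finset.sum_congr rfl fun T hT => ?_
    rw [prod_linFactor_eq_sum, Polynomial.finsetSum_coeff, ← Finset.sum_filter]
    simp only [Polynomial.coeff_C_mul, Polynomial.coeff_X_pow, mul_ite, mul_one, mul_zero]
    rw [← Finset.sum_filter]
    refine Finset.sum_congr ?_ ?_
    · ext S
      simp only [Finset.mem_filter, Finset.mem_powerset, Finset.mem_powersetCard]
      constructor
      · rintro ⟨h1, h2⟩
        exact ⟨⟨h1.trans (Finset.mem_powersetCard.1 hT).1, h2.symm⟩, h1⟩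
      · rintro ⟨⟨_, h2⟩, h3⟩
        exact ⟨h3, h2.symm⟩
    · intro S hS
      rw [(Finset.mem_powersetCard.1 (Finset.mem_filter.1 hS).1).2]
  rw [h1, Finset.sum_comm, elemSymm, Finset.smul_sum]
  refine Finset.sum_congr ?_ ?_
  · ext S
    simp [hU, Finset.mem_powersetCard, Finset.subset_iff]
  · intro S hS
    have hS' : S ∈ Finset.powersetCard r U := by
      simpa [hU, Finset.mem_powersetCard, Finset.subset_iff] using hS
    obtain ⟨hSU, hSr⟩ := Finset.mem_powersetCard.1 hS'
    rw [← Finset.sum_filter, Finset.sum_const,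
      card_filter_subset_powersetCard hSU (by omega), hUc, hSr, nsmul_eq_mul,
      Algebra.smul_def, map_mul, map_pow, map_neg, map_one, map_natCast]
    ring

theorem coeff_linFactorSum_of_lt {N m r : ℕ} (hr : m < r) : (linFactorSum n N m).coeff r = 0 := by
  apply Polynomial.coeff_eq_zero_of_natDegree_lt
  refine lt_of_le_of_lt (Polynomial.natDegree_sum_le_of_forall_le _ _ fun T hT => ?_) hr
  refine (Polynomial.natDegree_prod_le _ _).trans ?_
  refine (Finset.sum_le_card_nsmul _ _ 1 fun c _ => ?_).trans ?_
  · rw [linFactor]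
    compute_degree
  · rw [(Finset.mem_powersetCard.1 hT).2, smul_eq_mul, mul_one]

/-- The coefficient of `q ^ (p - c)` in `linFactorSum`, zero if `p < c`. -/
noncomputable def hookCoeff (n N m p c : ℕ) : Poly n :=
  if c ≤ p then (linFactorSum n N m).coeff (p - c) else 0

/-- The sum is the coefficient of `q^p` in the generating function times `linFactorSum`. Multiplying
by the factors in `T` turns exponents for `∅` into exponents for `T`, so `hp` makes every summand
vanish. -/
theorem map_sum_vdm_smul_hookCoeff [Algebra ℚ R] (φ : Poly n →ₐ[ℚ] R) {b : Fin s → Fin n}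
    (hb : Function.Injective b) (N m p : ℕ) (hφ : ∏ a, linFactor (φ (MvPolynomial.X a)) = 1)
    (hp : ∀ σ (T : Finset (Fin n)), T.card = m →
      (∏ a, linFactor (φ (MvPolynomial.X a)) ^ hookExponent b σ T a).coeff p = 0) :
    φ (∑ j ∈ Fintype.piFinset fun _ : Fin s => Finset.range n,
      vdm (fun v => (j v : ℚ)) • (hookCoeff n N m p (∑ v, j v) *
        ∏ v, MvPolynomial.X (b v) ^ j v)) = 0 := by
  classical
  rw [map_sum]
  have h1 : ∀ j : Fin s → ℕ, φ (vdm (fun v => (j v : ℚ)) •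
      (hookCoeff n N m p (∑ v, j v) * ∏ v, MvPolynomial.X (b v) ^ j v)) =
      ((vdm (fun v => (j v : ℚ)) • ∏ v, (Polynomial.C (φ (MvPolynomial.X (b v))) * Polynomial.X) ^ j v) *
        (linFactorSum n N m).map (φ : Poly n →+* R)).coeff p := fun j => by
    have h2 : ∏ v, (Polynomial.C (φ (MvPolynomial.X (b v))) * Polynomial.X) ^ j v =
        Polynomial.C (φ (∏ v, MvPolynomial.X (b v) ^ j v)) * Polynomial.X ^ ∑ v, j v := by
      simp only [mul_pow, Finset.prod_mul_distrib, Finset.prod_pow_eq_pow_sum, map_prod, map_pow]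
    rw [map_smul, map_mul, smul_mul_assoc, Polynomial.coeff_smul, h2, mul_assoc,
      Polynomial.coeff_C_mul, Polynomial.coeff_X_pow_mul', hookCoeff, mul_comm]
    congr 2
    split_ifs
    · rw [Polynomial.coeff_map, RingHom.coe_coe]
    · rw [map_zero]
  simp only [h1]
  rw [← Polynomial.finsetSum_coeff, ← Finset.sum_mul, sum_vdm_smul_prod_pow hb hφ, smul_mul_assoc,
    Polynomial.coeff_smul, Finset.sum_mul, Polynomial.finsetSum_coeff]
  have h3 : (linFactorSum n N m).map (φ : Poly n →+* R) =
      ∑ T ∈ Finset.powersetCard m {a : Fin n | (a : ℕ) < N},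
        ∏ a ∈ T, linFactor (φ (MvPolynomial.X a)) := by
    simp only [linFactorSum, Polynomial.map_sum, Polynomial.map_prod, map_linFactor,
      RingHom.coe_coe]
  rw [h3, Finset.sum_eq_zero, smul_zero]
  intro τ _
  rw [mul_assoc, Finset.mul_sum, ← Polynomial.C_eq_intCast, Polynomial.coeff_C_mul,
    Polynomial.finsetSum_coeff, Finset.sum_eq_zero, mul_zero]
  intro T hT
  have h4 : (∏ a, linFactor (φ (MvPolynomial.X a)) ^ hookExponent b (τ.trans Fin.revPerm) ∅ a) *
      ∏ a ∈ T, linFactor (φ (MvPolynomial.X a)) =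
      ∏ a, linFactor (φ (MvPolynomial.X a)) ^ hookExponent b (τ.trans Fin.revPerm) T a := by
    rw [prod_linFactor_pow_hookExponent hb, prod_linFactor_pow_hookExponent hb,
      Finset.prod_empty, mul_one]
  rw [h4]
  exact hp _ T (Finset.mem_powersetCard.1 hT).2

theorem sum_vdm_smul_hookCoeff_mem (hs : s ≤ n) {b : Fin s → Fin n}
    (hb : Function.Injective b) (N : ℕ) {p : ℕ} (hp : s.choose 2 + (n - s) * s < p) :
    ∑ j ∈ Fintype.piFinset fun _ : Fin s => Finset.range n,
      vdm (fun v => (j v : ℚ)) • (hookCoeff n N (n - s) p (∑ v, j v) *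
        ∏ v, MvPolynomial.X (b v) ^ j v) ∈ vdmAnnihilator n :=
  Ideal.Quotient.eq_zero_iff_mem.1 <|
    map_sum_vdm_smul_hookCoeff (coinvMk n) hb N (n - s) p prod_linFactor_coinvMk
      fun σ T hT => coeff_prod_linFactor_coinvMk hs hb σ T hT hp

end GeneratingFunction

end HarmonicForms

namespace HarmonicForms

/-! ### From increasing tuples to all tuples. -/

section Symmetrization

variable {n s : ℕ} {M : Type*} [AddCommMonoid M]

theorem strictMono_sort_of_injective {j : Fin s → ℕ} (hj : Function.Injective j) :
    StrictMono (j ∘ Tuple.sort j) :=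
  (Tuple.monotone_sort j).strictMono_of_injective (hj.comp (Tuple.sort j).injective)

open Classical in
/-- A symmetric function supported on injective tuples is summed over strictly increasing
tuples. -/
theorem sum_piFinset_eq_factorial_smul (f : (Fin s → ℕ) → M)
    (hf : ∀ j (σ : Equiv.Perm (Fin s)), f (j ∘ σ) = f j)
    (hf0 : ∀ j, ¬ Function.Injective j → f j = 0) :
    ∑ j ∈ Fintype.piFinset fun _ : Fin s => Finset.range n, f j =
      s.factorial • ∑ j ∈ Fintype.piFinset fun _ : Fin s => Finset.range n with StrictMono j,
        f j := by
  have h1 : ∑ x ∈ {j ∈ Fintype.piFinset fun _ : Fin s => Finset.range n | StrictMono j} ×ˢ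
      (Finset.univ : Finset (Equiv.Perm (Fin s))), f x.1 =
      ∑ j ∈ Fintype.piFinset fun _ : Fin s => Finset.range n with Function.Injective j, f j := by
    refine Finset.sum_bij (fun x _ => x.1 ∘ x.2) ?_ ?_ ?_ ?_
    · rintro ⟨j, σ⟩ hx
      simp only [Finset.mem_product, Finset.mem_filter, Fintype.mem_piFinset, Finset.mem_univ,
        and_true] at hx ⊢
      exact ⟨fun v => hx.1 _, hx.2.injective.comp σ.injective⟩
    · rintro ⟨j, σ⟩ hx ⟨j', σ'⟩ hx' h
      simp only [Finset.mem_product, Finset.mem_filter, Fintype.mem_piFinset, Finset.mem_univ,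
        and_true] at hx hx' h
      have hj : j = j' := by
        apply (StrictMono.range_inj hx.2 hx'.2).1
        have := congrArg Set.range h
        rwa [σ.surjective.range_comp, σ'.surjective.range_comp] at this
      subst hj
      refine Prod.ext rfl (Equiv.ext fun v => hx.2.injective (congrFun h v))
    · intro j hj
      simp only [Finset.mem_filter, Fintype.mem_piFinset] at hj
      refine ⟨(j ∘ Tuple.sort j, (Tuple.sort j)⁻¹), ?_, ?_⟩
      · simp only [Finset.mem_product, Finset.mem_filter, Fintype.mem_piFinset, Finset.mem_univ,
          and_true]
        exact ⟨fun v => hj.1 _, strictMono_sort_of_injective hj.2⟩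
      · funext v
        simp
    · rintro ⟨j, σ⟩ _
      exact (hf j σ).symm
  rw [← Finset.sum_subset (Finset.filter_subset (fun j => Function.Injective j) _), ← h1,
    Finset.sum_product]
  · simp only [Finset.sum_const, Finset.card_univ, Fintype.card_perm, Fintype.card_fin]
    rw [Finset.smul_sum]
  · intro j hj hj'
    apply hf0
    intro hinj
    exact hj' (Finset.mem_filter.2 ⟨hj, hinj⟩)

end Symmetrization

/-! ### Expansion of the forms in products of the anticommuting variables. -/

section FormExpansion

variable {n k : ℕ}

/-- The product of the `θ`'s indexed by a tuple. -/
noncomputable def thetaProd (n : ℕ) {k : ℕ} (a : Fin k → Fin n) : ExteriorAlgebra ℚ (Fin n → ℚ) :=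
  ExteriorAlgebra.ιMulti ℚ k fun l => (Pi.single (a l) 1 : Fin n → ℚ)

theorem thetaProd_comp_perm (a : Fin k → Fin n) (σ : Equiv.Perm (Fin k)) :
    thetaProd n (a ∘ σ) = ((Equiv.Perm.sign σ : ℤ) : ℚ) • thetaProd n a := by
  have := (ExteriorAlgebra.ιMulti ℚ k).map_perm (fun l => (Pi.single (a l) 1 : Fin n → ℚ)) σ
  rw [Int.cast_smul_eq_zsmul]
  exact this

theorem thetaProd_eq_zero (a : Fin k → Fin n) (ha : ¬ Function.Injective a) :
    thetaProd n a = 0 := by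
  refine AlternatingMap.map_eq_zero_of_not_injective _ _ fun h => ha ?_
  intro x y hxy
  exact h (by simp only [hxy])

theorem prod_ofFn_tensorMap {M N : Type*} [AddCommGroup M] [AddCommGroup N] [Module ℚ M]
    [Module ℚ N] (A : Fin k → Module.End ℚ M) (B : Fin k → Module.End ℚ N) :
    (List.ofFn fun l => TensorProduct.map (A l) (B l)).prod =
      TensorProduct.map (List.ofFn A).prod (List.ofFn B).prod := by
  induction k with
  | zero => simp
  | succ k ih =>
    rw [List.ofFn_succ, List.prod_cons, ih, List.ofFn_succ, List.ofFn_succ, List.prod_cons,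
      List.prod_cons, TensorProduct.map_mul]

theorem prod_ofFn_sum {A ι : Type*} [Ring A] [Algebra ℚ A] [Fintype ι] (F : Fin k → ι → A) :
    (List.ofFn fun l => ∑ a, F l a).prod =
      ∑ a : Fin k → ι, (List.ofFn fun l => F l (a l)).prod := by
  have := (MultilinearMap.mkPiAlgebraFin ℚ k A).map_sum F
  simpa only [MultilinearMap.mkPiAlgebraFin_apply] using this

theorem formDiff_dVandermonde (g : Poly n) (j : Fin k → ℕ) :
    formDiff g (dVandermonde n j) = ∑ a : Fin k → Fin n,
      polyDiffHom n (g * ∏ l, MvPolynomial.X (a l) ^ j l)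
        (vdm (MvPolynomial.X : Fin n → Poly n)) ⊗ₜ[ℚ] thetaProd n a := by
  have h0 : (List.ofFn fun l => genD n (j l)).prod = ∑ a : Fin k → Fin n,
      (List.ofFn fun l => TensorProduct.map (partialX n (a l) ^ j l)
        (LinearMap.mulLeft ℚ (theta n (a l)))).prod :=
    prod_ofFn_sum fun l a => TensorProduct.map (partialX n a ^ j l)
      (LinearMap.mulLeft ℚ (theta n a))
  rw [dVandermonde, h0, LinearMap.sum_apply, map_sum]
  refine Finset.sum_congr rfl fun a _ => ?_
  have h1 : (List.ofFn fun l => partialX n (a l) ^ j l).prod =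
      polyDiffHom n (∏ l, MvPolynomial.X (a l) ^ j l) := by
    rw [← List.prod_ofFn, map_list_prod, List.map_ofFn]
    congr 2
    funext l
    simp [polyDiffHom_X]
  have h2 : (List.ofFn fun l => LinearMap.mulLeft ℚ (theta n (a l))).prod (1 : ExteriorAlgebra ℚ _) =
      thetaProd n a := by
    have : (List.ofFn fun l => LinearMap.mulLeft ℚ (theta n (a l))).prod =
        Algebra.lmul ℚ _ (List.ofFn fun l => theta n (a l)).prod := by
      rw [map_list_prod, List.map_ofFn]
      rfl
    rw [this, thetaProd, ExteriorAlgebra.ιMulti_apply, Algebra.coe_lmul_eq_mul,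
      LinearMap.mul_apply', mul_one]
    rfl
  rw [prod_ofFn_tensorMap, vandermondeForm, TensorProduct.map_tmul, h1, h2, formDiff,
    LinearMap.rTensor_tmul, ← polyDiffHom_apply, map_mul, Module.End.mul_apply]

theorem formDiff_dVandermonde_comp_perm (g : Poly n) (j : Fin k → ℕ) (σ : Equiv.Perm (Fin k)) :
    formDiff g (dVandermonde n (j ∘ σ)) =
      ((Equiv.Perm.sign σ : ℤ) : ℚ) • formDiff g (dVandermonde n j) := by
  rw [formDiff_dVandermonde, formDiff_dVandermonde, Finset.smul_sum,
    ← Equiv.sum_comp (Equiv.arrowCongr σ.symm (Equiv.refl (Fin n)))]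
  refine Finset.sum_congr rfl fun a _ => ?_
  have h1 : (Equiv.arrowCongr σ.symm (Equiv.refl (Fin n))) a = a ∘ σ := by
    ext l; simp
  rw [h1, thetaProd_comp_perm, TensorProduct.tmul_smul]
  congr 4
  exact congrArg (g * ·) (Equiv.prod_comp σ fun l => (MvPolynomial.X (a l) : Poly n) ^ j l)

theorem formDiff_dVandermonde_append_comp_perm {r s : ℕ} (g : Poly n) (j₀ : Fin r → ℕ)
    (j : Fin s → ℕ) (σ : Equiv.Perm (Fin s)) :
    formDiff g (dVandermonde n (Fin.append j₀ (j ∘ σ))) =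
      ((Equiv.Perm.sign σ : ℤ) : ℚ) • formDiff g (dVandermonde n (Fin.append j₀ j)) := by
  have h := formDiff_dVandermonde_comp_perm g (Fin.append j₀ j)
    (finSumFinEquiv.permCongr (Equiv.sumCongr (1 : Equiv.Perm (Fin r)) σ))
  have hsign : Equiv.Perm.sign (finSumFinEquiv.permCongr
      (Equiv.sumCongr (1 : Equiv.Perm (Fin r)) σ)) = Equiv.Perm.sign σ := by
    rw [Equiv.Perm.sign_permCongr]
    exact (Equiv.Perm.sign_sumCongr 1 σ).trans (by simp)
  rw [hsign] at h
  rw [← h]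
  congr 2
  funext l
  refine Fin.addCases (fun l => ?_) (fun l => ?_) l
  · simp [Equiv.permCongr_apply]
  · simp [Equiv.permCongr_apply]

open Classical in
/-- The relation among the forms `d_J Δ_n`, summed over increasing tuples. -/
theorem sum_vdm_smul_formDiff_hookCoeff {r s : ℕ} (hs : s ≤ n) (j₀ : Fin r → ℕ) (N : ℕ) {p : ℕ}
    (hp : s.choose 2 + (n - s) * s < p) :
    ∑ j ∈ Fintype.piFinset fun _ : Fin s => Finset.range n with StrictMono j,
      vdm (fun v => (j v : ℚ)) • formDiff (hookCoeff n N (n - s) p (∑ v, j v))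
        (dVandermonde n (Fin.append j₀ j)) = 0 := by
  have hsymm := sum_piFinset_eq_factorial_smul (n := n) (fun j : Fin s → ℕ =>
    vdm (fun v => (j v : ℚ)) • formDiff (hookCoeff n N (n - s) p (∑ v, j v))
        (dVandermonde n (Fin.append j₀ j))) (fun j σ => by
      simp only [Function.comp_apply]
      rw [formDiff_dVandermonde_append_comp_perm, Equiv.sum_comp σ j,
        show (fun v => (j (σ v) : ℚ)) = (fun v => (j v : ℚ)) ∘ σ from rfl, vdm_comp_perm, smul_smul,
        mul_right_comm, ← Int.cast_mul, Int.units_coe_mul_self, Int.cast_one, one_mul])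
    (fun j hj => by
      rw [vdm_eq_zero, zero_smul]
      intro h
      exact hj fun x y hxy => h (by simp only [hxy]))
  have hzero : ∑ j ∈ Fintype.piFinset fun _ : Fin s => Finset.range n,
      vdm (fun v => (j v : ℚ)) • formDiff (hookCoeff n N (n - s) p (∑ v, j v))
        (dVandermonde n (Fin.append j₀ j)) = 0 := by
    simp only [formDiff_dVandermonde, Finset.smul_sum]
    rw [Finset.sum_comm]
    refine Finset.sum_eq_zero fun a _ => ?_
    by_cases ha : Function.Injective a
    · have hb : Function.Injective fun v : Fin s => a (Fin.natAdd r v) :=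
        ha.comp fun v w hvw => by simpa [Fin.ext_iff] using hvw
      -- Only the last `s` exponents vary; the first `r` positions contribute a fixed monomial,
      -- harmless because the annihilator is an ideal.
      have hmem := Ideal.mul_mem_left _ (∏ l : Fin r, MvPolynomial.X (a (Fin.castAdd s l)) ^ j₀ l)
        (sum_vdm_smul_hookCoeff_mem hs hb N hp)
      rw [mem_vdmAnnihilator] at hmem
      have hterm (c : ℚ) (g : Poly n) :
          c • polyDiffHom n g (vdm MvPolynomial.X) ⊗ₜ[ℚ] thetaProd n a =
            polyDiffHom n (c • g) (vdm MvPolynomial.X) ⊗ₜ[ℚ] thetaProd n a := by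
        rw [map_smul, LinearMap.smul_apply, TensorProduct.smul_tmul']
      simp only [hterm]
      rw [← TensorProduct.sum_tmul, ← LinearMap.sum_apply, ← map_sum]
      have hsum : ∑ j ∈ Fintype.piFinset fun _ : Fin s => Finset.range n,
          vdm (fun v => (j v : ℚ)) • (hookCoeff n N (n - s) p (∑ v, j v) *
            ∏ l, MvPolynomial.X (a l) ^ Fin.append j₀ j l) =
          (∏ l : Fin r, MvPolynomial.X (a (Fin.castAdd s l)) ^ j₀ l) *
            ∑ j ∈ Fintype.piFinset fun _ : Fin s => Finset.range n,
              vdm (fun v => (j v : ℚ)) • (hookCoeff n N (n - s) p (∑ v, j v) *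
                ∏ v, MvPolynomial.X (a (Fin.natAdd r v)) ^ j v) := by
        rw [Finset.mul_sum]
        refine Finset.sum_congr rfl fun j _ => ?_
        rw [Fin.prod_univ_add, mul_smul_comm]
        simp only [Fin.append_left, Fin.append_right]
        rw [mul_left_comm]
      rw [hsum, hmem, TensorProduct.zero_tmul]
    · refine Finset.sum_eq_zero fun j _ => ?_
      rw [thetaProd_eq_zero a ha, TensorProduct.tmul_zero, smul_zero]
  rw [hzero] at hsymm
  have := hsymm.symm
  rw [← Nat.cast_smul_eq_nsmul ℚ] at this
  exact (smul_eq_zero.1 this).resolve_left (by exact_mod_cast Nat.factorial_ne_zero s)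

end FormExpansion

end HarmonicForms

namespace HarmonicForms

/-! ### The compositions attached to subsets. -/

section Compositions

theorem Phi_of_empty (n : ℕ) : Phi n ∅ = List.replicate n 1 := by
  rw [Phi, dif_neg (by simp)]

/-- The elements of `I` exceeding `n - |I|`, shifted down by `n - |I|`. -/
def upperPart (n : ℕ) (I : Finset ℕ) : Finset ℕ :=
  {i ∈ I | n - I.card < i}.image fun i => i - (n - I.card)

theorem card_upperPart (n : ℕ) (I : Finset ℕ) :
    (upperPart n I).card = {i ∈ I | n - I.card < i}.card := by
  refine Finset.card_image_of_injOn fun x hx y hy hxy => ?_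
  simp only [Finset.coe_filter, Set.mem_ofPred_eq] at hx hy hxy
  omega

theorem card_upperPart_add (n : ℕ) (I : Finset ℕ) :
    (upperPart n I).card + {i ∈ I | i ≤ n - I.card}.card = I.card := by
  have h := Finset.card_filter_add_card_filter_not (s := I) fun i => n - I.card < i
  simp only [not_lt] at h
  rw [card_upperPart, h]

theorem card_lt_of_subset_Ico {n : ℕ} {I : Finset ℕ} (hn : 0 < n) (hI : I ⊆ Finset.Ico 1 n) :
    I.card < n := by
  have := Finset.card_le_card hI
  rw [Nat.card_Ico] at this
  omega

theorem upperPart_subset {n : ℕ} {I : Finset ℕ} (hI : I ⊆ Finset.Ico 1 n) :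
    upperPart n I ⊆ Finset.Ico 1 I.card := by
  intro x hx
  obtain ⟨i, hi, rfl⟩ := Finset.mem_image.1 hx
  rw [Finset.mem_filter] at hi
  have h1 := Finset.mem_Ico.1 (hI hi.1)
  have h2 := card_lt_of_subset_Ico (by omega) hI
  rw [Finset.mem_Ico]
  omega

theorem Phi_of_nonempty {n : ℕ} {I : Finset ℕ} (h0 : 0 < I.card) (h1 : I.card < n) :
    Phi n I = (List.range (n - I.card)).map fun a =>
      if n - I.card - a ∈ I then
        1 + (Phi I.card (upperPart n I)).getD
          {i ∈ I | n - I.card - a < i ∧ i ≤ n - I.card}.card 0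
      else 1 := by
  rw [Phi, dif_pos ⟨h0, h1⟩]
  rfl

theorem length_Phi {n : ℕ} {I : Finset ℕ} (hI : I ⊆ Finset.Ico 1 n) :
    (Phi n I).length = n - I.card := by
  rcases Finset.eq_empty_or_nonempty I with rfl | hne
  · simp [Phi_of_empty]
  · obtain ⟨i, hi⟩ := hne
    have h1 := Finset.mem_Ico.1 (hI hi)
    rw [Phi_of_nonempty (Finset.card_pos.2 ⟨i, hi⟩) (card_lt_of_subset_Ico (by omega) hI)]
    simp

theorem one_le_of_mem_Phi {n : ℕ} {I : Finset ℕ} {x : ℕ} (hx : x ∈ Phi n I) : 1 ≤ x := by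
  rw [Phi] at hx
  split_ifs at hx
  · obtain ⟨a, _, rfl⟩ := List.mem_map.1 hx
    split_ifs <;> omega
  · exact (List.eq_of_mem_replicate hx).ge

/-- Reading off a list at the successive elements of a finite set gives an initial segment. -/
theorem filter_map_range_getD (p : ℕ → Prop) [DecidablePred p] (β : List ℕ)
    (hβ : ∀ x ∈ β, 1 ≤ x) (N : ℕ) (hN : ((List.range N).countP (p ·)) ≤ β.length) :
    (((List.range N).map fun a =>
        if p a then β.getD ((List.range a).countP (p ·)) 0 else 0).filter fun a => a ≠ 0) =
      β.take ((List.range N).countP (p ·)) := by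
  induction N with
  | zero => simp
  | succ N ih =>
    rw [List.range_succ, List.countP_append] at hN ⊢
    rw [List.map_append, List.filter_append, ih (by omega)]
    by_cases h : p N
    · simp only [List.countP_singleton, h, decide_true, if_true] at hN ⊢
      have hlt : (List.range N).countP (p ·) < β.length := by omega
      have h1 := hβ _ (List.getElem_mem hlt)
      have h2 : β[(List.range N).countP (p ·)] ≠ 0 := by omega
      rw [List.take_add_one, List.getElem?_eq_getElem hlt, List.map_singleton, if_pos h,
        List.getD_eq_getElem _ _ hlt, List.filter_cons_of_pos (by simpa using h2)]
      rfl
    · simp [h]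

theorem countP_range_eq (c a : ℕ) (I : Finset ℕ) (ha : a ≤ c) :
    (List.range a).countP (fun b => c - b ∈ I) = {i ∈ I | c - a < i ∧ i ≤ c}.card := by
  induction a with
  | zero =>
    rw [Finset.card_eq_zero.2]
    · simp
    · ext i; simp
  | succ a ih =>
    rw [List.range_succ, List.countP_append, ih (by omega), List.countP_singleton]
    have h1 : {i ∈ I | c - (a + 1) < i ∧ i ≤ c} =
        if c - a ∈ I then insert (c - a) {i ∈ I | c - a < i ∧ i ≤ c}
        else {i ∈ I | c - a < i ∧ i ≤ c} := by
      ext i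
      split_ifs with h
      · simp only [Finset.mem_filter, Finset.mem_insert]
        constructor
        · rintro ⟨h2, h3, h4⟩
          by_cases h5 : i = c - a
          · exact Or.inl h5
          · exact Or.inr ⟨h2, by omega, h4⟩
        · rintro (rfl | ⟨h2, h3, h4⟩)
          · exact ⟨h, by omega, by omega⟩
          · exact ⟨h2, by omega, h4⟩
      · simp only [Finset.mem_filter]
        constructor
        · rintro ⟨h2, h3, h4⟩
          refine ⟨h2, ?_, h4⟩
          have : i ≠ c - a := by rintro rfl; exact h h2
          omega
        · rintro ⟨h2, h3, h4⟩
          exact ⟨h2, by omega, h4⟩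
    rw [h1]
    by_cases h : c - a ∈ I
    · rw [if_pos h, Finset.card_insert_of_notMem (by simp)]
      simp [h]
    · simp [h]

/-- The entries above `1` are `1 + β_1, 1 + β_2, …`, so only their number is at issue: it is the
number of `i ∈ I` with `i ≤ n - |I|`, which is exactly the length of `β`. -/
theorem reduced_Phi {n : ℕ} {I : Finset ℕ} (hI : I ⊆ Finset.Ico 1 n) (h0 : 0 < I.card) :
    reduced (Phi n I) = Phi I.card (upperPart n I) := by
  obtain ⟨i, hi⟩ := Finset.card_pos.1 h0
  have hn := Finset.mem_Ico.1 (hI hi)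
  have hlt := card_lt_of_subset_Ico (by omega) hI
  have hpos : ∀ i ∈ I, 1 ≤ i := fun i hi => (Finset.mem_Ico.1 (hI hi)).1
  have hlen := length_Phi (upperPart_subset hI)
  -- This equality also means that the default value of `getD` is never read.
  have hcount : (List.range (n - I.card)).countP (fun b => n - I.card - b ∈ I) =
      (Phi I.card (upperPart n I)).length := by
    rw [countP_range_eq _ _ I le_rfl, hlen]
    have h2 := card_upperPart_add n I
    have h3 : {i ∈ I | n - I.card - (n - I.card) < i ∧ i ≤ n - I.card} =
        {i ∈ I | i ≤ n - I.card} := by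
      ext i
      simp only [Finset.mem_filter, Nat.sub_self]
      exact ⟨fun h => ⟨h.1, h.2.2⟩, fun h => ⟨h.1, hpos i h.1, h.2⟩⟩
    rw [h3]
    omega
  rw [Phi_of_nonempty h0 hlt, reduced, List.map_map]
  have key := filter_map_range_getD (fun b => n - I.card - b ∈ I) (Phi I.card (upperPart n I))
    (fun x hx => one_le_of_mem_Phi hx) (n - I.card) hcount.le
  rw [hcount, List.take_length] at key
  refine Eq.trans ?_ key
  congr 1
  refine List.map_congr_left fun a ha => ?_
  rw [List.mem_range] at ha
  rw [countP_range_eq _ _ I ha.le]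
  simp only [Function.comp_apply]
  split_ifs <;> simp

theorem upperPart_Ico {m : ℕ} (hm : 1 ≤ m) :
    upperPart (m + 1) (Finset.Ico 1 (m + 1)) = Finset.Ico 1 m := by
  ext x
  simp only [upperPart, Finset.mem_image, Finset.mem_filter, Finset.mem_Ico, Nat.card_Ico]
  constructor
  · rintro ⟨i, hi, rfl⟩; omega
  · intro hx; exact ⟨x + 1, by omega, by omega⟩

theorem Phi_Ico {m : ℕ} (hm : 1 ≤ m) : Phi m (Finset.Ico 1 m) = [m] := by
  induction m, hm using Nat.le_induction with
  | base => simp [Phi_of_empty]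
  | succ m hm ih =>
    rw [Phi_of_nonempty (by simp; omega) (by simp), upperPart_Ico hm]
    simp only [Nat.card_Ico, Nat.add_sub_cancel, ih]
    have h1 : {i ∈ Finset.Ico 1 (m + 1) | 1 < i ∧ i ≤ 1} = ∅ := by
      ext i; simp only [Finset.mem_filter, Finset.notMem_empty, iff_false]; omega
    simp [h1, add_comm]

theorem reduced_cons_replicate (s t : ℕ) (hs : 2 ≤ s) :
    reduced (s :: List.replicate t 1) = [s - 1] := by
  have : s - 1 ≠ 0 := by omega
  simp [reduced, this]

/-- The sets whose composition is `(s, 1, …, 1)`. -/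
theorem Phi_eq_cons_replicate_iff {k s : ℕ} (hs : 1 ≤ s) (hsk : s ≤ k) {I : Finset ℕ}
    (hI : I ⊆ Finset.Ico 1 k) :
    Phi k I = s :: List.replicate (k - s) 1 ↔ I = Finset.Ico (k - s + 1) k := by
  have hk := card_lt_of_subset_Ico (by omega) hI
  constructor
  · intro h
    have hlen := congrArg List.length h
    rw [length_Phi hI, List.length_cons, List.length_replicate] at hlen
    have hcard : I.card = s - 1 := by omega
    rcases Nat.lt_or_ge 1 s with h2 | h2
    · have h3 := congrArg reduced h
      rw [reduced_Phi hI (by omega), reduced_cons_replicate _ _ h2] at h3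
      have h4 := congrArg List.length h3
      rw [length_Phi (upperPart_subset hI), List.length_singleton, card_upperPart] at h4
      -- The leading entry `s` exceeds `1`, which forces the largest admissible position value `k -
      -- |I| = k - s + 1` into `I`.
      have hmem : k - s + 1 ∈ I := by
        rw [Phi_of_nonempty (by omega) hk] at h
        have hc : k - I.card = k - s + 1 := by omega
        rw [hc, List.range_succ_eq_map, List.map_cons, List.cons_eq_cons] at h
        by_contra hcon
        have h5 := h.1
        rw [Nat.sub_zero, if_neg hcon] at h5
        omega
      have hsub : {i ∈ I | k - I.card < i} ⊆ Finset.Ico (k - s + 2) k := by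
        intro i hi
        rw [Finset.mem_filter] at hi
        have := Finset.mem_Ico.1 (hI hi.1)
        rw [Finset.mem_Ico]
        omega
      -- The reduced composition has one part, so the upper part has `s - 2` elements and fills the
      -- whole interval.
      have heq := Finset.eq_of_subset_of_card_le hsub (by rw [Nat.card_Ico]; omega)
      symm
      apply Finset.eq_of_subset_of_card_le
      · intro i hi
        rw [Finset.mem_Ico] at hi
        by_cases h6 : i = k - s + 1
        · rwa [h6]
        · have : i ∈ Finset.Ico (k - s + 2) k := Finset.mem_Ico.2 (by omega)
          rw [← heq] at this
          exact (Finset.mem_filter.1 this).1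
      · rw [Nat.card_Ico]; omega
    · have : I = ∅ := Finset.card_eq_zero.1 (by omega)
      rw [this, Finset.Ico_eq_empty (by omega)]
  · intro h
    have hcard : I.card = s - 1 := by rw [h, Nat.card_Ico]; omega
    rcases Nat.lt_or_ge 1 s with h2 | h2
    · have hup : upperPart k I = Finset.Ico 1 (s - 1) := by
        ext x
        simp only [upperPart, Finset.mem_image, Finset.mem_filter, Finset.mem_Ico, h]
        constructor
        · rintro ⟨i, hi, rfl⟩
          rw [Nat.card_Ico] at *
          omega
        · intro hx
          refine ⟨x + (k - (s - 1)), ?_, ?_⟩ <;> simp only [Nat.card_Ico] <;> omega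
      have hk1 : k - I.card = k - s + 1 := by omega
      rw [Phi_of_nonempty (by omega) hk, hup, hcard, Phi_Ico (by omega)]
      rw [hcard] at hk1
      rw [hk1, List.range_succ_eq_map, List.map_cons, List.cons_eq_cons, List.map_map]
      constructor
      · have he : {i ∈ I | k - s + 1 - 0 < i ∧ i ≤ k - s + 1} = ∅ := by
          ext i; simp only [Finset.mem_filter, Finset.notMem_empty, iff_false]; omega
        rw [he, if_pos (by rw [h, Finset.mem_Ico]; omega)]
        simp only [Finset.card_empty, List.getD_cons_zero]
        omega
      · rw [List.eq_replicate_iff]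
        refine ⟨by simp, fun b hb => ?_⟩
        obtain ⟨a, _, rfl⟩ := List.mem_map.1 hb
        simp only [Function.comp_apply]
        rw [if_neg]
        rw [h, Finset.mem_Ico]
        omega
    · have hs1 : s = 1 := by omega
      have : I = ∅ := Finset.card_eq_zero.1 (by omega)
      rw [this, Phi_of_empty, hs1, ← List.replicate_succ]
      congr 1
      omega

end Compositions

end HarmonicForms

namespace HarmonicForms

/-! ### The extreme hook condition and the resulting relations. -/

section HookRelations

theorem add_sub_le_of_strictMono {k : ℕ} {f : Fin k → ℕ} (hf : StrictMono f) {l l' : Fin k}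
    (h : l ≤ l') : f l + (l' - l : ℕ) ≤ f l' := by
  obtain ⟨d, hd⟩ := Nat.exists_eq_add_of_le (Fin.le_def.1 h)
  induction d generalizing l' with
  | zero =>
    have : l' = l := Fin.ext hd
    simp [this]
  | succ d ih =>
    have h1 : (⟨l + d, by omega⟩ : Fin k) < l' := Fin.lt_def.2 (by simp only; omega)
    have h2 := ih (l' := ⟨l + d, by omega⟩) (Fin.le_def.2 (by simp only; omega)) rfl
    have h3 := hf h1
    simp only at h2
    omega

theorem add_le_of_strictMono {k n : ℕ} {f : Fin k → ℕ} (hf : StrictMono f) (hn : ∀ l, f l < n)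
    (l : Fin k) : f l + k ≤ n + l := by
  have hl := l.isLt
  have h1 := add_sub_le_of_strictMono hf (l := l) (l' := ⟨k - 1, by omega⟩)
    (Fin.le_def.2 (by simp only; omega))
  have h2 := hn ⟨k - 1, by omega⟩
  simp only at h1
  omega

theorem isExtremeHook_iff_upperPart {n k s : ℕ} (hs : 1 ≤ s) (hsk : s ≤ k) {i : Fin k → ℕ}
    (hi : StrictMono i) (hin : ∀ l, 1 ≤ i l ∧ i l < n) :
    IsExtremeHook n s i ↔ upperPart n (Finset.univ.image i) = Finset.Ico (k - s + 1) k := by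
  have hcard : (Finset.univ.image i).card = k := by
    rw [Finset.card_image_of_injective _ hi.injective, Finset.card_univ, Fintype.card_fin]
  have hmem (x : ℕ) : x ∈ upperPart n (Finset.univ.image i) ↔
      ∃ l, n - k < i l ∧ i l - (n - k) = x := by
    simp [upperPart, hcard]
  have hkn : k < n := by
    have h0 := hin ⟨0, by omega⟩
    have h1 := add_le_of_strictMono hi (fun l => (hin l).2) ⟨0, by omega⟩
    simp only at h1
    omega
  have hupper (l : Fin k) : i l + k ≤ n + l := add_le_of_strictMono hi (fun l => (hin l).2) l
  constructor
  · rintro ⟨h1, h2⟩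
    ext x
    rw [hmem, Finset.mem_Ico]
    constructor
    · rintro ⟨l, hl, rfl⟩
      have h3 : k - s < l := by
        by_contra hcon
        have := h1 l (by omega)
        omega
      have h4 := h2 l (l - (k - s)) (by omega) (by omega)
      have := l.isLt
      omega
    · intro hx
      have h4 := h2 ⟨x, hx.2⟩ (x - (k - s)) (by omega) (by simp only; omega)
      exact ⟨⟨x, hx.2⟩, by omega, by omega⟩
  · intro h
    have hlow : ∀ l : Fin k, n - k < i l → k - s + 1 ≤ i l - (n - k) := fun l hl => by
      have := (hmem _).2 ⟨l, hl, rfl⟩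
      rw [h, Finset.mem_Ico] at this
      exact this.1
    have hfirst : ∀ l : Fin k, (l : ℕ) ≤ k - s → i l ≤ n - k := fun l hl => by
      by_contra hcon
      have h3 := hlow l (by omega)
      have h4 := hupper l
      omega
    refine ⟨hfirst, fun l t ht hlt => ?_⟩
    have hl := l.isLt
    have hmem1 : k - s + 1 ∈ upperPart n (Finset.univ.image i) := by
      rw [h, Finset.mem_Ico]; omega
    obtain ⟨l1, hl1, hl1'⟩ := (hmem _).1 hmem1
    have h5 : k - s + 1 ≤ l1 := by
      by_contra hcon
      have := hfirst l1 (by omega)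
      omega
    have h6 := hupper l
    -- The `s - 1` elements of the upper part come from indices at least `l1`, so `l1` cannot be
    -- larger. From there on strict growth and the upper bound `n` determine all entries.
    have h7 : (l1 : ℕ) = k - s + 1 := by
      by_contra hcon
      have hcount : (upperPart n (Finset.univ.image i)).card ≤
          (Finset.Ico (l1 : ℕ) k).card := by
        refine (Finset.card_le_card (t := (Finset.univ.filter fun l => l1 ≤ l).image
          fun l => i l - (n - k)) ?_).trans ?_
        · intro x hx
          obtain ⟨l3, hl3, rfl⟩ := (hmem _).1 hx
          refine Finset.mem_image.2 ⟨l3, Finset.mem_filter.2 ⟨Finset.mem_univ _, ?_⟩, rfl⟩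
          by_contra hcon2
          have h9 := hi (not_le.1 hcon2)
          have h10 := hlow l3 hl3
          omega
        · refine Finset.card_image_le.trans ?_
          rw [Finset.filter_le_eq_Ici, Fin.card_Ici, Nat.card_Ico]
      rw [h, Nat.card_Ico, Nat.card_Ico] at hcount
      omega
    have h11 := add_sub_le_of_strictMono hi (l := l1) (l' := l) (Fin.le_def.2 (by omega))
    omega

theorem formDiff_smul {n : ℕ} (c : ℚ) (g : Poly n) : formDiff (c • g) = c • formDiff g := by
  rw [formDiff, formDiff, ← polyDiffHom_apply, ← polyDiffHom_apply, map_smul,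
    LinearMap.rTensor_smul]

theorem formDiff_zero {n : ℕ} : formDiff (0 : Poly n) = 0 := by
  rw [formDiff, ← polyDiffHom_apply, map_zero, LinearMap.rTensor_zero]

theorem elemSymm_of_neg {n N : ℕ} {r : ℤ} (hr : r < 0) : elemSymm n N r = 0 := by
  rw [elemSymm]
  refine Finset.sum_eq_zero fun S hS => ?_
  have := (Finset.mem_filter.1 hS).2.2
  omega

theorem lastEntries_eq {r s : ℕ} (h : s ≤ r + s) (j : Fin (r + s) → ℕ) :
    lastEntries h j = fun t => j (Fin.natAdd r t) := by
  funext t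
  rw [lastEntries]
  congr 1
  ext
  simp

/-- The coefficient index would exceed the degree `m`; thus tuples of negative excess drop out by
themselves. -/
theorem hookCoeff_of_lt {n N m c₀ c : ℕ} (h : c < c₀) : hookCoeff n N m (c₀ + m) c = 0 := by
  rw [hookCoeff, if_pos (by omega), coeff_linFactorSum_of_lt (by omega)]

theorem hookCoeff_add {n u m c₀ e : ℕ} (h : m + u ≤ n) :
    hookCoeff n (m + u) m (c₀ + m) (c₀ + e) =
      ((-1 : ℚ) ^ m * ((-1) ^ e * ((e + u).choose u : ℚ))) • elemSymm n (m + u) ((m : ℤ) - e) := by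
  rw [hookCoeff]
  by_cases he : e ≤ m
  · rw [if_pos (by omega), show c₀ + m - (c₀ + e) = m - e by omega,
      coeff_linFactorSum h (Nat.sub_le m e), show m + u - (m - e) = e + u by omega,
      show m - (m - e) = e by omega, Nat.cast_sub he, Nat.choose_symm_add, ← mul_assoc]
    congr 2
    obtain ⟨f, rfl⟩ := Nat.exists_eq_add_of_le he
    rw [Nat.add_sub_cancel_left, pow_add, mul_right_comm, ← pow_add, ← two_mul, pow_mul]
    simp
  · rw [if_neg (by omega), elemSymm_of_neg (by omega), smul_zero]

/-- All but the first of the last `s` entries are prescribed. Hence the coefficient index used later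
exceeds the bound for vanishing by exactly the remaining entry, which is at least `1`. -/
theorem sum_lastEntries_of_isExtremeHook {n r s : ℕ} (hs : 1 ≤ s) {i : Fin (r + s) → ℕ}
    (h : IsExtremeHook n s i) :
    ∑ t, i (Fin.natAdd r t) + (n - s) =
      i (Fin.natAdd r ⟨0, hs⟩) + s * (n - s) + s.choose 2 := by
  obtain ⟨s, rfl⟩ : ∃ s', s = s' + 1 := ⟨s - 1, by omega⟩
  rw [Fin.sum_univ_succ]
  have h1 : ∀ t : Fin s, i (Fin.natAdd r t.succ) = n - (s + 1) + (t + 1) := fun t =>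
    h.2 _ _ (by omega) (by simp)
  simp only [h1, Finset.sum_add_distrib, Finset.sum_const, Finset.card_univ, Fintype.card_fin]
  rw [Fin.sum_univ_eq_sum_range (fun t => t), Finset.sum_range_id, ← Nat.choose_two_right,
    choose_two_succ, smul_eq_mul, smul_eq_mul, mul_one, show (0 : Fin (s + 1)) = ⟨0, hs⟩ from rfl]
  ring

/-- Past its first entry, the tail of `i` is as large as an increasing tuple below `n` can be. A
tail `j` with at least the same sum therefore cannot start lower, and the concatenation stays
increasing. -/
theorem append_mem_admissible {n r s : ℕ} (hs : 1 ≤ s) {i : Fin (r + s) → ℕ} (hi : StrictMono i)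
    (hin : ∀ l, 1 ≤ i l ∧ i l < n) (h : IsExtremeHook n s i) {j : Fin s → ℕ} (hj : StrictMono j)
    (hjn : ∀ t, j t < n) (hsum : ∑ t, i (Fin.natAdd r t) ≤ ∑ t, j t) :
    Fin.append (fun l => i (Fin.castAdd s l)) j ∈ admissible n (Nat.le_add_left s r) i := by
  have hfirst : i (Fin.natAdd r ⟨0, hs⟩) ≤ j ⟨0, hs⟩ := by
    by_contra! hcon
    refine absurd hsum (not_le.2 (Finset.sum_lt_sum (fun t _ => ?_) ⟨_, Finset.mem_univ _, hcon⟩))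
    rcases Nat.eq_zero_or_pos (t : ℕ) with h0 | h0
    · have : t = ⟨0, hs⟩ := Fin.ext h0
      rw [this]
      exact hcon.le
    · have h1 := h.2 (Fin.natAdd r t) t h0 (by simp)
      have h2 := add_le_of_strictMono hj hjn t
      omega
  have hle : ∀ t, i (Fin.natAdd r ⟨0, hs⟩) ≤ j t := fun t =>
    hfirst.trans (hj.monotone (Fin.le_def.2 (Nat.zero_le _)))
  have hpos := (hin (Fin.natAdd r ⟨0, hs⟩)).1
  rw [admissible, Finset.mem_filter, Fintype.mem_piFinset]
  refine ⟨fun l => ?_, ?_, ?_, ?_⟩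
  · rw [Finset.mem_Icc]
    refine Fin.addCases (fun l => ?_) (fun t => ?_) l
    · rw [Fin.append_left]
      have := hin (Fin.castAdd s l)
      omega
    · rw [Fin.append_right]
      have := hle t
      have := hjn t
      omega
  · intro l l'
    refine Fin.addCases (fun l => ?_) (fun t => ?_) l <;>
      refine Fin.addCases (fun l' => ?_) (fun t' => ?_) l' <;> intro hlt <;>
      simp only [Fin.append_left, Fin.append_right]
    · exact hi hlt
    · exact lt_of_lt_of_le (hi (Fin.lt_def.2 (by
        simp only [Fin.val_castAdd, Fin.val_natAdd]; omega))) (hle t')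
    · rw [Fin.lt_def] at hlt
      simp only [Fin.val_natAdd, Fin.val_castAdd] at hlt
      omega
    · refine hj (Fin.lt_def.2 ?_)
      rw [Fin.lt_def, Fin.val_natAdd, Fin.val_natAdd] at hlt
      omega
  · intro l hl
    have hl' : (l : ℕ) < r := by omega
    have : l = Fin.castAdd s ⟨l, hl'⟩ := rfl
    rw [this, Fin.append_left]
  · rw [excess, lastEntries_eq, lastEntries_eq, Finset.sum_sub_distrib]
    simp only [Fin.append_right]
    rw [sub_nonneg]
    exact_mod_cast hsum

theorem sum_admissible_eq_zero {n r s u : ℕ} (hs : 1 ≤ s) (hus : u ≤ s) {i : Fin (r + s) → ℕ}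
    (hi : StrictMono i) (hin : ∀ l, 1 ≤ i l ∧ i l < n) (h : IsExtremeHook n s i)
    (hsk : s ≤ r + s) :
    ∑ j ∈ admissible n hsk i,
      ((-1 : ℚ) ^ (excess hsk i j).toNat * vdm (fun t => ((lastEntries hsk j t : ℕ) : ℚ)) *
        (((excess hsk i j).toNat + u).choose u : ℚ)) •
          formDiff (elemSymm n (n - s + u) ((n : ℤ) - s - excess hsk i j)) (dVandermonde n j) =
      0 := by
  classical
  have hsn : s ≤ n := by
    have := add_le_of_strictMono hi (fun l => (hin l).2) (Fin.natAdd r ⟨0, hs⟩)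
    have := (hin (Fin.natAdd r ⟨0, hs⟩)).1
    simp only [Fin.val_natAdd] at *
    omega
  set c₀ := ∑ t, i (Fin.natAdd r t) with hc₀
  have hp : s.choose 2 + (n - s) * s < c₀ + (n - s) := by
    rw [hc₀, sum_lastEntries_of_isExtremeHook hs h, mul_comm s]
    have := (hin (Fin.natAdd r ⟨0, hs⟩)).1
    omega
  have hrel := sum_vdm_smul_formDiff_hookCoeff hsn (fun l => i (Fin.castAdd s l)) (n - s + u) hp
  have hexc (j : Fin (r + s) → ℕ) : excess hsk i j =
      ((∑ t, j (Fin.natAdd r t) : ℕ) : ℤ) - (c₀ : ℤ) := by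
    rw [excess, lastEntries_eq, lastEntries_eq, Finset.sum_sub_distrib, hc₀]
    push_cast
    rfl
  rw [← Finset.sum_filter_of_ne (p := fun j : Fin s → ℕ => c₀ ≤ ∑ t, j t)] at hrel
  swap
  · intro j _ hne
    by_contra hcon
    exact hne (by rw [hookCoeff_of_lt (not_le.1 hcon), formDiff_zero, LinearMap.zero_apply,
      smul_zero])
  -- This cancels the global sign `(-1)^(n-s)` produced by `hookCoeff_add`.
  have hscaled := congrArg (fun ω => (-1 : ℚ) ^ (n - s) • ω) hrel
  simp only [smul_zero] at hscaled
  rw [← hscaled, Finset.smul_sum]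
  refine Finset.sum_bij' (fun j _ t => j (Fin.natAdd r t))
    (fun j _ => Fin.append (fun l => i (Fin.castAdd s l)) j) ?_ ?_ ?_ ?_ ?_
  · intro j hj
    rw [admissible, Finset.mem_filter, Fintype.mem_piFinset, hexc] at hj
    obtain ⟨h1, h2, h3, h4⟩ := hj
    simp only [Finset.mem_filter, Fintype.mem_piFinset, Finset.mem_range]
    refine ⟨⟨fun t => ?_, h2.comp (Fin.strictMono_natAdd r)⟩, by omega⟩
    have := Finset.mem_Icc.1 (h1 (Fin.natAdd r t))
    omega
  · intro j hj
    simp only [Finset.mem_filter, Fintype.mem_piFinset, Finset.mem_range] at hj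
    exact append_mem_admissible hs hi hin h hj.1.2 hj.1.1 hj.2
  · intro j hj
    rw [admissible, Finset.mem_filter] at hj
    funext l
    refine Fin.addCases (fun l => ?_) (fun t => ?_) l
    · rw [Fin.append_left, hj.2.2.1 _ (by simp)]
    · rw [Fin.append_right]
  · intro j hj
    funext t
    rw [Fin.append_right]
  · intro j hj
    rw [admissible, Finset.mem_filter, hexc] at hj
    obtain ⟨_, _, h3, h4⟩ := hj
    have happ : Fin.append (fun l => i (Fin.castAdd s l)) (fun t => j (Fin.natAdd r t)) = j := by
      funext l
      refine Fin.addCases (fun l => ?_) (fun t => ?_) l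
      · rw [Fin.append_left, h3 _ (by simp)]
      · rw [Fin.append_right]
    obtain ⟨e, he⟩ := Nat.exists_eq_add_of_le (show c₀ ≤ ∑ t, j (Fin.natAdd r t) by omega)
    have hexc' : excess hsk i j = e := by rw [hexc, he]; push_cast; ring
    have hns : (n : ℤ) - s - e = ((n - s : ℕ) : ℤ) - e := by rw [Nat.cast_sub hsn]
    rw [hexc', Int.toNat_natCast, lastEntries_eq, happ, he, hookCoeff_add (by omega),
      formDiff_smul, LinearMap.smul_apply, smul_smul, smul_smul, hns]
    congr 1
    have hsq : (-1 : ℚ) ^ (n - s) * (-1) ^ (n - s) = 1 := by rw [← mul_pow]; simp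
    linear_combination (-(-1 : ℚ) ^ e * vdm (fun t => (j (Fin.natAdd r t) : ℚ)) *
      ((e + u).choose u : ℚ)) * hsq

end HookRelations

end HarmonicForms

theorem theorem1p11 (n k s : ℕ) (hs1 : 1 ≤ s) (hsk : s ≤ k) (i : Fin k → ℕ)
    (hi : StrictMono i) (hin : ∀ l, 1 ≤ i l ∧ i l ≤ n - 1) :
    (HarmonicForms.IsExtremeHook n s i ↔
      HarmonicForms.reduced (HarmonicForms.Phi n (Finset.univ.image i)) =
        s :: List.replicate (k - s) 1) ∧
    (HarmonicForms.IsExtremeHook n s i → ∀ u : ℕ, u ≤ s →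
      ∑ j ∈ HarmonicForms.admissible n hsk i,
        ((-1 : ℚ) ^ (HarmonicForms.excess hsk i j).toNat *
          HarmonicForms.vdm (fun t => ((HarmonicForms.lastEntries hsk j t : ℕ) : ℚ)) *
          (((HarmonicForms.excess hsk i j).toNat + u).choose u : ℚ)) •
            HarmonicForms.formDiff
              (HarmonicForms.elemSymm n (n - s + u) ((n : ℤ) - s - HarmonicForms.excess hsk i j))
              (HarmonicForms.dVandermonde n j) = 0) := by
  have hin' : ∀ l, 1 ≤ i l ∧ i l < n := fun l => by
    have := hin l
    omega
  constructor
  · have hI : Finset.univ.image i ⊆ Finset.Ico 1 n := by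
      intro x hx
      obtain ⟨l, _, rfl⟩ := Finset.mem_image.1 hx
      exact Finset.mem_Ico.2 (hin' l)
    have hcard : (Finset.univ.image i).card = k := by
      rw [Finset.card_image_of_injective _ hi.injective, Finset.card_univ, Fintype.card_fin]
    have hup := HarmonicForms.upperPart_subset hI
    rw [HarmonicForms.reduced_Phi hI (by omega), hcard,
      HarmonicForms.Phi_eq_cons_replicate_iff hs1 hsk (by rwa [hcard] at hup)]
    exact HarmonicForms.isExtremeHook_iff_upperPart hs1 hsk hi hin'
  · intro h u hu
    obtain ⟨r, rfl⟩ := Nat.exists_eq_add_of_le' hsk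
    exact HarmonicForms.sum_admissible_eq_zero hs1 hu hi hin' h hsk
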